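/- **Definitions.** A dual number is $x=x_{st}+x_{in}\epsilon$ with $x_{st},x_{in}\in\mathbb R$ and $\epsilon^2=0$; dual numbers are totally ordered lexicographically ($x<y$ iff $x_{st}<y_{st}$, or $x_{st}=y_{st}$ and $x_{in}<y_{in}$), and $x$ is *appreciable* if $x_{st}\neq 0$. A dual quaternion is $q=q_{st}+q_{in}\epsilon$ with $q_{st},q_{in}$ real quaternions, where $\epsilon$ commutes with quaternions; its conjugate is $q^*=q_{st}^*+q_{in}^*\epsilon$. $\mathbb{DQ}^{m\times n}$ is the set of $m\times n$ matrices of dual quaternions, $A^*=(a_{ji}^*)$, and a square $U$ is unitary if $U^*U=UU^*=I$. Every $A\in\mathbb{DQ}^{m\times n}$ has a singular value decomposition $U^*AV=\begin{pmatrix}\mathrm{diag}(\mu_1,\dots,\mu_t)&0\\0&0\end{pmatrix}$ with $U,V$ unitary and uniquely determined dual numbers $\mu_1\ge\dots\ge\mu_t>0$; the rank of $A$ is $t$, and its appreciable rank $\mathrm{Arank}(A)$ is the number of appreciable $\mu_i$. A *unitary decomposition* of $A\in\mathbb{DQ}^{m\times n}$ of rank $p$ is a factorization $A=Q_AR_1$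 where $Q_A\in\mathbb{DQ}^{m\times p}$ has orthonormal columns ($Q_A^*Q_A=I_p$) and $R_1\in\mathbb{DQ}^{p\times n}$ is, up to a permutation of its columns, upper trapezoidal. **Theorem (DQCCD).** Let $A\in\mathbb{DQ}^{m\times n}$ have rank $p$ and $B\in\mathbb{DQ}^{m\times l}$ have rank $q$. There exist a unitary $Q\in\mathbb{DQ}^{m\times m}$ and matrices $X_A\in\mathbb{DQ}^{n\times n}$, $X_B\in\mathbb{DQ}^{l\times l}$ such that $$A=Q(\Sigma_A,0)X_A,\qquad B=Q(\Sigma_B,0)X_B,\qquad \Sigma_B=\begin{pmatrix}I_q\\0\end{pmatrix}\in\mathbb{DQ}^{m\times q},$$ $$\Sigma_A=\left(\begin{array}{ccccc}I_r&0&0&0&0\\0&I_u&0&0&0\\0&0&C&0&0\\0&0&0&D\epsilon&0\\0&0&0&0&0\\\hline\Sigma\epsilon&0&0&0&0\\0&0&0&0&0\\0&0&S&0&0\\0&0&0&I_t&0\\0&0&0&0&I_w\end{array}\right)\in\mathbb{DQ}^{m\times p},$$ for some nonnegative integers $r,u,j,t,v,z,w$ with $r+u+j+t+v=q$, $r+u+j+t+w=p$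 and $r+z+j+t+w=m-q$, where the column blocks have $r,u,j,t,w$ columns, the upper row blocks have $r,u,j,t,v$ rows and the lower row blocks have $r,z,j,t,w$ rows (any block may be empty). Here $\Sigma=\mathrm{diag}(\sigma_1,\dots,\sigma_r)$ and $D=\mathrm{diag}(d_1,\dots,d_t)$ are real with $\sigma_1\ge\dots\ge\sigma_r>0$ and $d_1\ge\dots\ge d_t>0$, while $C=\mathrm{diag}(c_1,\dots,c_j)$ and $S=\mathrm{diag}(s_1,\dots,s_j)$ have appreciable dual number diagonal entries with $$1>c_1\ge\dots\ge c_j>0,\qquad 0<s_1\le\dots\le s_j<1,\qquad C^2+S^2=I_j.$$ Moreover, $Q$, $X_A$, $X_B$ can be chosen so that: 1. if $\mathrm{Arank}(A)=p$ then $X_A$ is nonsingular, and if $\mathrm{Arank}(B)=q$ then $X_B$ is nonsingular; 2. there are unitary decompositions $A=Q_AR_1$, $B=Q_BR_2$, square matrices $R_A\in\mathbb{DQ}^{n\times n}$ and $R_B\in\mathbb{DQ}^{l\times l}$ whose first $p$, respectively $q$, rows are $R_1$, respectively $R_2$, a unitary $Q_2\in\mathbb{DQ}^{m\times m}$ whose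 first $q$ columns are $Q_B$, and unitary $U_1\in\mathbb{DQ}^{q\times q}$, $U_2\in\mathbb{DQ}^{(m-q)\times(m-q)}$, $V_1\in\mathbb{DQ}^{p\times p}$ with $\mathrm{diag}(U_1,U_2)^*\,Q_2^*Q_A\,V_1=\Sigma_A$ and $$Q=Q_2\,\mathrm{diag}(U_1,U_2),\qquad X_A=\mathrm{diag}(V_1,I_{n-p})^*R_A,\qquad X_B=\mathrm{diag}(U_1,I_{l-q})^*R_B.$$ -/

import Mathlib

open scoped Quaternion DualNumber Matrix

/-- Dual quaternions `q = q_st + q_in ε` with `q_st, q_in` real quaternions, `ε² = 0` and `ε`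
commuting with all quaternions; `fst` is the standard part, `snd` the infinitesimal part. -/
abbrev DQ : Type := DualNumber ℍ[ℝ]

/-- The conjugate `q* = q_st* + q_in* ε`. On matrices over `DQ`, Mathlib's conjugate transpose
built from this star is `A* = (a_ji*)`. -/
noncomputable instance instStarRingDQ : StarRing DQ where
  star x := (star x.fst, star x.snd)
  star_involutive x := by
    apply TrivSqZeroExt.ext
    · exact star_star x.fst
    · exact star_star x.snd
  star_mul x y := by
    apply TrivSqZeroExt.ext
    · exact star_mul x.fst y.fst
    · change star (x * y).snd = star y.fst * star x.snd + star y.snd * star x.fst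
      rw [DualNumber.snd_mul, star_add, star_mul, star_mul, add_comm]
  star_add x y := by
    apply TrivSqZeroExt.ext
    · exact star_add x.fst y.fst
    · exact star_add x.snd y.snd

/-- Matrices of dual quaternions with `m` rows and `n` columns. -/
abbrev DQMat (m n : ℕ) : Type := Matrix (Fin m) (Fin n) DQ

/-- `U` is unitary: `U* U = U U* = I`. -/
def IsUnitaryDQ {m : ℕ} (U : DQMat m m) : Prop := Uᴴ * U = 1 ∧ U * Uᴴ = 1

/-- The strict total order of dual numbers (lexicographic in standard and infinitesimal part). -/
def DualLT (x y : ℝ[ε]) : Prop := x.fst < y.fst ∨ (x.fst = y.fst ∧ x.snd < y.snd)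

/-- The total order of dual numbers. -/
def DualLE (x y : ℝ[ε]) : Prop := DualLT x y ∨ x = y

/-- A dual number is appreciable when its standard part is nonzero. -/
def DualAppreciable (x : ℝ[ε]) : Prop := x.fst ≠ 0

/-- Dual numbers as dual quaternions. -/
noncomputable def dualToDQ (x : ℝ[ε]) : DQ :=
  TrivSqZeroExt.inl (x.fst : ℍ[ℝ]) + TrivSqZeroExt.inr (x.snd : ℍ[ℝ])

/-- The infinitesimal dual quaternion `x ε` of a real number `x`. -/
noncomputable def realEps (x : ℝ) : DQ := TrivSqZeroExt.inr (x : ℍ[ℝ])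

/-- The `m × n` matrix with upper left block `diag(μ₁, …, μ_t)` and all other entries zero. -/
noncomputable def svdForm (m n t : ℕ) (μ : Fin t → ℝ[ε]) : DQMat m n :=
  Matrix.of fun i k => if h : i.val = k.val ∧ i.val < t then dualToDQ (μ ⟨i.val, h.2⟩) else 0

/-- `U* A V = [Σ_t, 0; 0, 0]` is a singular value decomposition of `A`: there are `t` nonzero
singular values `μ₁ ≥ μ₂ ≥ … ≥ μ_t > 0`, of which exactly the first `r` are appreciable. -/
structure IsDQSVD {m n : ℕ} (A : DQMat m n) (U : DQMat m m) (V : DQMat n n)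
    (r t : ℕ) (μ : Fin t → ℝ[ε]) : Prop where
  unitary_left : IsUnitaryDQ U
  unitary_right : IsUnitaryDQ V
  r_le : r ≤ t
  t_le : t ≤ min m n
  eq : Uᴴ * A * V = svdForm m n t μ
  pos : ∀ a, DualLT 0 (μ a)
  anti : ∀ a b, a ≤ b → DualLE (μ b) (μ a)
  appreciable_iff : ∀ a, DualAppreciable (μ a) ↔ a.val < r

/-- The rank of `A`: the number of nonzero singular values. Every `A` has a singular value
decomposition and its singular values are unique, so the infimum is over a one-element set. -/
noncomputable def dqRank {m n : ℕ} (A : DQMat m n) : ℕ :=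
  sInf {t | ∃ (r : ℕ) (μ : Fin t → ℝ[ε]) (U : DQMat m m) (V : DQMat n n), IsDQSVD A U V r t μ}

/-- The appreciable rank of `A`: the number of appreciable singular values (again the infimum
is over a one-element set). -/
noncomputable def dqArank {m n : ℕ} (A : DQMat m n) : ℕ :=
  sInf {r | ∃ (t : ℕ) (μ : Fin t → ℝ[ε]) (U : DQMat m m) (V : DQMat n n), IsDQSVD A U V r t μ}

/-- The `m × n` matrix `(M, 0)`, for `M` with `p ≤ n` columns. -/
noncomputable def padCols {m p : ℕ} (n : ℕ) (M : DQMat m p) : DQMat m n :=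
  Matrix.of fun i k => if h : k.val < p then M i ⟨k.val, h⟩ else 0

/-- The block diagonal `m × m` matrix `diag(U₁, U₂)` with `U₁` of order `q ≤ m`. -/
noncomputable def diagTwo {m q : ℕ} (U₁ : DQMat q q) (U₂ : DQMat (m - q) (m - q)) : DQMat m m :=
  Matrix.of fun i k =>
    if h : i.val < q ∧ k.val < q then U₁ ⟨i.val, h.1⟩ ⟨k.val, h.2⟩
    else if h : q ≤ i.val ∧ q ≤ k.val then
      U₂ ⟨i.val - q, by omega⟩ ⟨k.val - q, by omega⟩
    else 0

/-- Five consecutive index blocks of the given lengths. -/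
abbrev Five (a b c d e : ℕ) : Type := Fin a ⊕ (Fin b ⊕ (Fin c ⊕ (Fin d ⊕ Fin e)))

/-- Concatenation, in order, of five index blocks. -/
def fiveEquiv (a b c d e : ℕ) : Five a b c d e ≃ Fin (a + (b + (c + (d + e)))) :=
  ((Equiv.refl (Fin a)).sumCongr (((Equiv.refl (Fin b)).sumCongr
    (((Equiv.refl (Fin c)).sumCongr finSumFinEquiv).trans finSumFinEquiv)).trans
      finSumFinEquiv)).trans finSumFinEquiv

/-- The upper part `diag(I_r, I_u, C, D ε, 0)` of `Σ_A`; the last zero block is `v × w`. -/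
noncomputable def sigmaTop (r u j t v w : ℕ) (c : Fin j → ℝ[ε]) (d : Fin t → ℝ) :
    Matrix (Five r u j t v) (Five r u j t w) DQ :=
  Matrix.fromBlocks 1 0 0
    (Matrix.fromBlocks 1 0 0
      (Matrix.fromBlocks (Matrix.diagonal fun a => dualToDQ (c a)) 0 0
        (Matrix.fromBlocks (Matrix.diagonal fun a => realEps (d a)) 0 0
          (0 : Matrix (Fin v) (Fin w) DQ))))

/-- The lower part `diag(Σ ε, 0, S, I_t, I_w)` of `Σ_A`; the zero block is `z × u`. -/
noncomputable def sigmaBot (r u z j t w : ℕ) (σ : Fin r → ℝ) (s : Fin j → ℝ[ε]) :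
    Matrix (Five r z j t w) (Five r u j t w) DQ :=
  Matrix.fromBlocks (Matrix.diagonal fun a => realEps (σ a)) 0 0
    (Matrix.fromBlocks (0 : Matrix (Fin z) (Fin u) DQ) 0 0
      (Matrix.fromBlocks (Matrix.diagonal fun a => dualToDQ (s a)) 0 0
        (Matrix.fromBlocks 1 0 0 1)))

/-- The `m × p` matrix `Σ_A`: `sigmaTop` (`q` rows) above `sigmaBot` (`m - q` rows). -/
noncomputable def sigmaA {m p q r u j t v z w : ℕ}
    (hq : r + (u + (j + (t + v))) = q) (hp : r + (u + (j + (t + w))) = p)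
    (hm : q + (r + (z + (j + (t + w)))) = m)
    (σ : Fin r → ℝ) (c s : Fin j → ℝ[ε]) (d : Fin t → ℝ) : DQMat m p :=
  Matrix.reindex
    (((((fiveEquiv r u j t v).trans (finCongr hq)).sumCongr (fiveEquiv r z j t w)).trans
      finSumFinEquiv).trans (finCongr hm))
    ((fiveEquiv r u j t w).trans (finCongr hp))
    (Matrix.fromRows (sigmaTop r u j t v w c d) (sigmaBot r u z j t w σ s))

/-- The `m × q` matrix `Σ_B`, the identity `I_q` above a zero block. -/
noncomputable def sigmaB (m q : ℕ) : DQMat m q :=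
  Matrix.of fun i k => if i.val = k.val then 1 else 0

/-- `A = (P, 0) R`, where the `p` columns of `P` are orthonormal and the first `p` rows of the
square matrix `R` form, after a permutation `π` of the columns, an upper trapezoidal matrix. -/
def IsUnitaryDecomp {m n p : ℕ} (A : DQMat m n) (P : DQMat m p) (R : DQMat n n) : Prop :=
  Pᴴ * P = 1 ∧ A = padCols n P * R ∧
    ∃ π : Equiv.Perm (Fin n), ∀ i k : Fin n, i.val < p → k < i → R i (π k) = 0

/-! ### Dual numbers inside the dual quaternions -/

/-! Factor `A` and `B` as orthonormal frames `PA`, `PB` (with `p` and `q` columns) times right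
factors, and complete `PB` to a unitary `Q₂`. In the coordinates of `Q₂` the frame of `B` is `I_q`
above zero, and the frame of `A` is a pair `W₁`, `W₂` with `W₁ᴴ * W₁ + W₂ᴴ * W₂ = 1`. A further
change `diag(U₁, U₂)` preserves the form of `B` up to `U₁ᴴ`, which `XB` absorbs, so everything
reduces to the CS decomposition of this pair (`exists_cs_decomposition`).

For that, take the singular value decomposition of `W₁` with right factor `V`. The columns of `W₂ *
V` are then orthogonal with squared norms `1 - μ²` (with `μ = 0` for the extra columns). Where the
norm is appreciable the columns can be normalized, which gives `S` and the identity blocks; an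
infinitesimal `μ = d ε` has `1 - μ² = 1`, whence `D ε` stands above `I_t`. Where `μ = 1` the norm
vanishes, but over dual quaternions this makes the columns only infinitesimal, not zero, since `(x
ε)* (x ε) = 0`. A second singular value decomposition, of this infinitesimal part, produces `Σ ε`.
It rotates only the columns carrying an identity block of `W₁`, so the upper half survives.

Singular value decompositions (`exists_svd`) come from deflation: split off a singular pair
(`exists_singular_pair`), complete both vectors to unitary matrices by Householder reflections
(`exists_unitary_first_column`), and recurse. If `A` has nonzero standard part, the pair comes from
an eigenvector of `Aᴴ * A`, found by first-order perturbation theory for symmetric operators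
(`LinearMap.IsSymmetric.exists_dual_eigenvector`); otherwise a factor `ε` is removed first. -/

@[simp] lemma fst_star_DQ (x : DQ) : (star x).fst = star x.fst := rfl

@[simp] lemma snd_star_DQ (x : DQ) : (star x).snd = star x.snd := rfl

@[simp] lemma fst_dualToDQ (x : ℝ[ε]) : (dualToDQ x).fst = (x.fst : ℍ[ℝ]) := by simp [dualToDQ]

@[simp] lemma snd_dualToDQ (x : ℝ[ε]) : (dualToDQ x).snd = (x.snd : ℍ[ℝ]) := by simp [dualToDQ]

/-- The embedding of the dual numbers into the dual quaternions, as a ring homomorphism. -/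
noncomputable def dualToDQHom : ℝ[ε] →+* DQ where
  toFun := dualToDQ
  map_one' := by ext1 <;> simp
  map_zero' := by ext1 <;> simp
  map_add' x y := by ext1 <;> simp
  map_mul' x y := by ext1 <;> simp

lemma dualToDQ_mul_comm (x : ℝ[ε]) (q : DQ) : dualToDQ x * q = q * dualToDQ x := by
  ext1
  · simp [Quaternion.coe_commutes]
  · simp [Quaternion.coe_commutes, add_comm]

/-- Dual numbers are central among the dual quaternions, so norms and singular values may act as
scalars on matrices and move past any factor. -/
noncomputable instance instAlgebraDualDQ : Algebra ℝ[ε] DQ :=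
  dualToDQHom.toAlgebra' dualToDQ_mul_comm

lemma dual_smul_def (x : ℝ[ε]) (q : DQ) : x • q = dualToDQ x * q := rfl

@[simp] lemma star_dualToDQ (x : ℝ[ε]) : star (dualToDQ x) = dualToDQ x := by ext1 <;> simp

@[simp] lemma dualToDQ_zero : dualToDQ 0 = 0 := map_zero dualToDQHom

@[simp] lemma dualToDQ_one : dualToDQ 1 = 1 := map_one dualToDQHom

lemma dualToDQ_mul (x y : ℝ[ε]) : dualToDQ (x * y) = dualToDQ x * dualToDQ y :=
  map_mul dualToDQHom x y

lemma dualToDQ_add (x y : ℝ[ε]) : dualToDQ (x + y) = dualToDQ x + dualToDQ y :=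
  map_add dualToDQHom x y

lemma dualToDQ_sum {ι : Type*} (s : Finset ι) (f : ι → ℝ[ε]) :
    dualToDQ (∑ i ∈ s, f i) = ∑ i ∈ s, dualToDQ (f i) := map_sum dualToDQHom f s

lemma dualToDQ_injective : Function.Injective dualToDQ := by
  intro x y h
  ext
  · have := congrArg (fun q : DQ => q.fst.re) h
    simpa using this
  · have := congrArg (fun q : DQ => q.snd.re) h
    simpa using this

lemma realEps_eq_dualToDQ (x : ℝ) : realEps x = dualToDQ (TrivSqZeroExt.inr x) := by
  ext1 <;> simp [realEps]

lemma star_dual_smul (x : ℝ[ε]) (q : DQ) : star (x • q) = x • star q := by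
  rw [dual_smul_def, star_mul, star_dualToDQ, dual_smul_def, dualToDQ_mul_comm]

lemma Matrix.conjTranspose_dual_smul {ι κ : Type*} (x : ℝ[ε]) (M : Matrix ι κ DQ) :
    (x • M)ᴴ = x • Mᴴ := by
  ext1 i j
  simp [star_dual_smul]

lemma dual_smul_smul {ι κ : Type*} (x y : ℝ[ε]) (M : Matrix ι κ DQ) : x • y • M = (x * y) • M :=
  smul_smul x y M

lemma dual_add_smul {ι κ : Type*} (x y : ℝ[ε]) (M : Matrix ι κ DQ) :
    (x + y) • M = x • M + y • M := add_smul x y M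

lemma dual_one_smul {ι κ : Type*} (M : Matrix ι κ DQ) : (1 : ℝ[ε]) • M = M := one_smul ℝ[ε] M

lemma dual_zero_smul {ι κ : Type*} (M : Matrix ι κ DQ) : (0 : ℝ[ε]) • M = 0 := zero_smul ℝ[ε] M

lemma dual_smul_zero {ι κ : Type*} (x : ℝ[ε]) : x • (0 : Matrix ι κ DQ) = 0 := by
  ext1 i j
  exact mul_zero (dualToDQ x)

lemma Matrix.dual_smul_mul {ι κ l : Type*} [Fintype κ] (x : ℝ[ε]) (M : Matrix ι κ DQ)
    (N : Matrix κ l DQ) : x • M * N = x • (M * N) := Matrix.smul_mul x M N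

lemma Matrix.mul_dual_smul {ι κ l : Type*} [Fintype κ] (x : ℝ[ε]) (M : Matrix ι κ DQ)
    (N : Matrix κ l DQ) : M * x • N = x • (M * N) := Matrix.mul_smul M x N

lemma Matrix.dual_smul_apply {ι κ : Type*} (x : ℝ[ε]) (M : Matrix ι κ DQ) (i : ι) (k : κ) :
    (x • M) i k = dualToDQ x * M i k := rfl

/-- A dual number with positive standard part has a square root with positive standard part. -/
lemma exists_dual_sqrt (a : ℝ[ε]) (h : 0 < a.fst) : ∃ b : ℝ[ε], b * b = a ∧ 0 < b.fst := by
  have hs := Real.sqrt_pos.2 h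
  -- The infinitesimal part solves `2 b_st b_in = a_in` with `b_st = √a_st`.
  refine ⟨(√a.fst, a.snd / (2 * √a.fst)), ?_, hs⟩
  ext
  · exact Real.mul_self_sqrt h.le
  · change √a.fst * (a.snd / (2 * √a.fst)) + (a.snd / (2 * √a.fst)) * √a.fst = a.snd
    field_simp
    norm_num

/-- A dual number with nonzero standard part is invertible. -/
lemma exists_dual_inv (a : ℝ[ε]) (h : a.fst ≠ 0) :
    ∃ b : ℝ[ε], a * b = 1 ∧ b.fst = a.fst⁻¹ :=
  ⟨a⁻¹, TrivSqZeroExt.mul_inv_cancel h, TrivSqZeroExt.fst_inv a⟩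

/-- The dual number `q* q`. -/
noncomputable def dualNormSq (q : DQ) : ℝ[ε] :=
  (Quaternion.normSq q.fst, 2 * (star q.fst * q.snd).re)

lemma star_mul_self_DQ (q : DQ) : star q * q = dualToDQ (dualNormSq q) := by
  ext1
  · rw [fst_dualToDQ, TrivSqZeroExt.fst_mul, fst_star_DQ]
    exact Quaternion.star_mul_self _
  · rw [snd_dualToDQ, DualNumber.snd_mul, fst_star_DQ, snd_star_DQ]
    change _ = ((2 * (star q.fst * q.snd).re : ℝ) : ℍ[ℝ])
    -- The infinitesimal part has the form `z + z*`, hence is the real number `2 Re z`.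
    rw [show star q.snd * q.fst = star (star q.fst * q.snd) by rw [star_mul, star_star]]
    rw [Quaternion.self_add_star, Quaternion.coe_mul]
    rfl

lemma mul_star_self_DQ (q : DQ) : q * star q = dualToDQ (dualNormSq q) := by
  rw [← star_mul_self_DQ]
  ext1
  · simp [Quaternion.star_mul_self, Quaternion.self_mul_star]
  · simp only [DualNumber.snd_mul, fst_star_DQ, snd_star_DQ]
    ext <;> simp <;> ring

/-- The dual number `∑ i, (x i)* (x i)`. -/
noncomputable def dualSqNorm {ι : Type*} [Fintype ι] (x : ι → DQ) : ℝ[ε] := ∑ i, dualNormSq (x i)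

lemma sum_star_mul_self_DQ {ι : Type*} [Fintype ι] (x : ι → DQ) :
    ∑ i, star (x i) * x i = dualToDQ (dualSqNorm x) := by
  simp only [star_mul_self_DQ, dualSqNorm, dualToDQ_sum]

lemma fst_dualSqNorm {ι : Type*} [Fintype ι] (x : ι → DQ) :
    (dualSqNorm x).fst = ∑ i, Quaternion.normSq (x i).fst := by
  rw [dualSqNorm, TrivSqZeroExt.fst_sum]
  rfl

lemma fst_dualSqNorm_nonneg {ι : Type*} [Fintype ι] (x : ι → DQ) : 0 ≤ (dualSqNorm x).fst := by
  rw [fst_dualSqNorm]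
  exact Finset.sum_nonneg fun i _ => Quaternion.normSq_nonneg

lemma fst_eq_zero_of_dualSqNorm {ι : Type*} [Fintype ι] {x : ι → DQ}
    (h : (dualSqNorm x).fst = 0) (i : ι) : (x i).fst = 0 := by
  rw [fst_dualSqNorm, Finset.sum_eq_zero_iff_of_nonneg fun i _ => Quaternion.normSq_nonneg] at h
  exact Quaternion.normSq_eq_zero.1 (h i (Finset.mem_univ i))

/-- The infinitesimal part of each `q* q` carries the factor `q_st`, so it dies with the standard
part. A squared norm is thus either appreciable or exactly zero, which later forces a singular value
with standard part `1` to equal `1`. -/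
lemma dualSqNorm_eq_zero {ι : Type*} [Fintype ι] {x : ι → DQ}
    (h : (dualSqNorm x).fst = 0) : dualSqNorm x = 0 := by
  refine Finset.sum_eq_zero fun i _ => ?_
  have := fst_eq_zero_of_dualSqNorm h i
  ext
  · change Quaternion.normSq (x i).fst = 0
    simp [this]
  · change 2 * (star (x i).fst * (x i).snd).re = 0
    simp [this]

lemma conjTranspose_mul_self_apply {ι κ : Type*} [Fintype ι] (Y : Matrix ι κ DQ) (k : κ) :
    (Yᴴ * Y) k k = dualToDQ (dualSqNorm fun i => Y i k) := by
  rw [← sum_star_mul_self_DQ, Matrix.mul_apply]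
  rfl

lemma conjTranspose_mul_self_column {ι : Type*} [Fintype ι] (x : Matrix ι Unit DQ) :
    xᴴ * x = dualSqNorm (fun i => x i ()) • (1 : Matrix Unit Unit DQ) := by
  ext1 i k
  rw [conjTranspose_mul_self_apply x ()]
  simp [dual_smul_def]

/-- A column with nonzero standard part can be normalized. -/
lemma exists_unit_smul {ι : Type*} [Fintype ι] (x : Matrix ι Unit DQ) (i₀ : ι)
    (h : (x i₀ ()).fst ≠ 0) :
    ∃ ρ : ℝ[ε], 0 < ρ.fst ∧ (ρ • x)ᴴ * (ρ • x) = 1 := by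
  set N := dualSqNorm (fun i => x i ()) with hN
  have hpos : 0 < N.fst := by
    refine lt_of_le_of_ne (fst_dualSqNorm_nonneg _) fun h0 => h ?_
    exact fst_eq_zero_of_dualSqNorm h0.symm i₀
  obtain ⟨b, hb, hb0⟩ := exists_dual_sqrt N hpos
  obtain ⟨c, hc, hc0⟩ := exists_dual_inv b hb0.ne'
  refine ⟨c, by rw [hc0]; positivity, ?_⟩
  rw [Matrix.conjTranspose_dual_smul, Matrix.dual_smul_mul, Matrix.mul_dual_smul,
    conjTranspose_mul_self_column, ← hN, dual_smul_smul, dual_smul_smul, ← hb,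
    show c * c * (b * b) = (b * c) * (b * c) by ring, hc, mul_one, dual_one_smul]

/-- Every column is a unit column times a dual number. -/
lemma exists_unit_mul {ι : Type*} [Fintype ι] [DecidableEq ι] [Nonempty ι] (x : Matrix ι Unit DQ) :
    ∃ (y : Matrix ι Unit DQ) (ρ : ℝ[ε]), 0 ≤ ρ.fst ∧ yᴴ * y = 1 ∧ x = ρ • y := by
  by_cases h : ∃ i, (x i ()).fst ≠ 0
  · obtain ⟨i, hi⟩ := h
    obtain ⟨ρ, h0, h1⟩ := exists_unit_smul x i hi
    obtain ⟨c, hc, hc0⟩ := exists_dual_inv ρ h0.ne'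
    refine ⟨_, c, by rw [hc0]; positivity, h1, ?_⟩
    rw [dual_smul_smul, mul_comm, hc, dual_one_smul]
  push Not at h
  by_cases h' : ∃ i, (x i ()).snd ≠ 0
  · obtain ⟨i, hi⟩ := h'
    -- Now `x` is `ε` times its infinitesimal part read as a standard column; that column is
    -- normalized and `ε` goes into the scalar.
    obtain ⟨ρ, h0, h1⟩ :=
      exists_unit_smul (Matrix.of fun i _ => (TrivSqZeroExt.inl (x i ()).snd : DQ)) i (by simpa)
    obtain ⟨c, hc, hc0⟩ := exists_dual_inv ρ h0.ne'
    refine ⟨_, TrivSqZeroExt.inr 1 * c, by simp, h1, ?_⟩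
    rw [dual_smul_smul, mul_assoc, mul_comm c, hc, mul_one]
    ext1 i j
    rw [Matrix.dual_smul_apply]
    ext1
    · simp [h]
    · simp
  · push Not at h'
    -- For `x = 0` any unit column serves, with scalar zero.
    refine ⟨Matrix.of fun i _ => if i = Classical.arbitrary ι then 1 else 0, 0, le_rfl, ?_, ?_⟩
    · ext1 i j
      simp [Matrix.mul_apply]
    · ext1 i j
      rw [dual_zero_smul]
      ext1
      · exact h i
      · exact h' i

/-! ### Unitary matrices with arbitrary row and column index types -/

/-- `U` is unitary: `U* U = 1` and `U U* = 1`. -/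
def Matrix.IsUnitaryRect {ι κ : Type*} [Fintype ι] [Fintype κ] [DecidableEq ι] [DecidableEq κ]
    (U : Matrix ι κ DQ) : Prop := Uᴴ * U = 1 ∧ U * Uᴴ = 1

namespace Matrix

variable {ι κ l n : Type*} [Fintype ι] [Fintype κ] [Fintype l] [Fintype n]
  [DecidableEq ι] [DecidableEq κ] [DecidableEq l] [DecidableEq n]

namespace IsUnitaryRect

lemma mul {U : Matrix ι κ DQ} {V : Matrix κ l DQ} (hU : U.IsUnitaryRect)
    (hV : V.IsUnitaryRect) : (U * V).IsUnitaryRect := by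
  constructor
  · rw [conjTranspose_mul, Matrix.mul_assoc, ← Matrix.mul_assoc Uᴴ, hU.1, Matrix.one_mul, hV.1]
  · rw [conjTranspose_mul, Matrix.mul_assoc, ← Matrix.mul_assoc V, hV.2, Matrix.one_mul, hU.2]

lemma conjTranspose {U : Matrix ι κ DQ} (hU : U.IsUnitaryRect) : Uᴴ.IsUnitaryRect :=
  ⟨by rw [conjTranspose_conjTranspose]; exact hU.2, by
    rw [conjTranspose_conjTranspose]; exact hU.1⟩

protected lemma one : (1 : Matrix ι ι DQ).IsUnitaryRect := ⟨by simp, by simp⟩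

lemma submatrix {U : Matrix ι κ DQ} (hU : U.IsUnitaryRect) (e : l ≃ ι) (f : n ≃ κ) :
    (U.submatrix e f).IsUnitaryRect := by
  constructor
  · rw [conjTranspose_submatrix, submatrix_mul_equiv, hU.1, submatrix_one_equiv]
  · rw [conjTranspose_submatrix, submatrix_mul_equiv, hU.2, submatrix_one_equiv]

lemma fromBlocks {U : Matrix ι κ DQ} {V : Matrix l n DQ} (hU : U.IsUnitaryRect)
    (hV : V.IsUnitaryRect) : (Matrix.fromBlocks U 0 0 V).IsUnitaryRect := by
  constructor <;>
  simp [fromBlocks_conjTranspose, fromBlocks_multiply, hU.1, hU.2, hV.1, hV.2]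

lemma mul_cancel_left {U : Matrix ι κ DQ} (hU : U.IsUnitaryRect) {m : Type*}
    (M : Matrix κ m DQ) : Uᴴ * (U * M) = M := by
  rw [← Matrix.mul_assoc, hU.1, Matrix.one_mul]

lemma mul_cancel_left' {U : Matrix ι κ DQ} (hU : U.IsUnitaryRect) {m : Type*}
    (M : Matrix ι m DQ) : U * (Uᴴ * M) = M := by
  rw [← Matrix.mul_assoc, hU.2, Matrix.one_mul]

end IsUnitaryRect

lemma conj_submatrix {ι κ α β α' β' : Type*} [Fintype ι] [Fintype κ] (U : Matrix ι α DQ)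
    (A : Matrix ι κ DQ) (V : Matrix κ β DQ) (f : α' ≃ α) (g : β' ≃ β) :
    (U.submatrix (Equiv.refl ι) f)ᴴ * A * V.submatrix (Equiv.refl κ) g =
      (Uᴴ * A * V).submatrix f g := rfl

/-- Standard parts turn mutually inverse rectangular matrices into such matrices over the
quaternions, where they must be square. All block-size identities rest on this. -/
instance : InvariantBasisNumber DQ := by
  rw [invariantBasisNumber_iff_matrix]
  intro n m f g h1 h2
  let φ : DQ →+* ℍ[ℝ] := TrivSqZeroExt.fstHom ℝ ℍ[ℝ] ℍ[ℝ]
  have := Matrix.square_of_invertible (f.map φ) (g.map φ)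
    (by rw [← Matrix.map_mul, h1]; simp) (by rw [← Matrix.map_mul, h2]; simp)
  simpa using this

lemma IsUnitaryRect.card_eq {U : Matrix ι κ DQ} (hU : U.IsUnitaryRect) :
    Fintype.card ι = Fintype.card κ :=
  Matrix.square_of_invertible U Uᴴ hU.2 hU.1

lemma isUnitaryRect_fromCols {X : Matrix ι κ DQ} {Y : Matrix ι l DQ} :
    (fromCols X Y).IsUnitaryRect ↔
      Xᴴ * X = 1 ∧ Xᴴ * Y = 0 ∧ Yᴴ * X = 0 ∧ Yᴴ * Y = 1 ∧ X * Xᴴ + Y * Yᴴ = 1 := by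
  rw [IsUnitaryRect, conjTranspose_fromCols_eq_fromRows_conjTranspose, fromRows_mul_fromCols,
    fromCols_mul_fromRows, ← fromBlocks_one, fromBlocks_inj]
  tauto

/-- Householder reflections: a unit column is the first column of a unitary matrix. -/
lemma exists_unitary_first_column (x : Matrix ι Unit DQ) (hx : xᴴ * x = 1) :
    ∃ (k : ℕ) (X : Matrix ι (Fin k) DQ), (fromCols x X).IsUnitaryRect := by
  have hne : Nonempty ι := by
    by_contra h
    rw [not_nonempty_iff] at h
    have := congrFun (congrFun hx ()) ()
    simp [Matrix.mul_apply] at this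
  have hpos : 0 < Fintype.card ι := Fintype.card_pos
  let f : Unit ⊕ Fin (Fintype.card ι - 1) ≃ ι := Fintype.equivOfCardEq (by simp; omega)
  let F : Matrix ι (Unit ⊕ Fin (Fintype.card ι - 1)) DQ := (1 : Matrix ι ι DQ).submatrix id f
  let e := F.toCols₁
  let E := F.toCols₂
  have hE : (fromCols e E).IsUnitaryRect := by
    rw [fromCols_toCols]
    exact IsUnitaryRect.one.submatrix (Equiv.refl ι) f
  -- The phase `y` of `eᴴ * x` is chosen so that reflecting `x` to `-(e * y)` uses `w = x + e * y`
  -- with `wᴴ * w = 2 (1 + ρ)`. Since `ρ` has nonnegative standard part, there is no cancellation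
  -- and `1 + ρ` is invertible.
  obtain ⟨y, ρ, hρ, hy, hxy⟩ := exists_unit_mul (eᴴ * x)
  have hy' : y * yᴴ = 1 := by
    rw [← hy]
    ext1 i j
    simp [Matrix.mul_apply, star_mul_self_DQ, mul_star_self_DQ]
  obtain ⟨c, hc, -⟩ := exists_dual_inv (1 + ρ) (by
    rw [TrivSqZeroExt.fst_add, TrivSqZeroExt.fst_one]; positivity)
  have hxe : xᴴ * e = ρ • yᴴ := by
    rw [← conjTranspose_dual_smul, ← hxy, conjTranspose_mul, conjTranspose_conjTranspose]
  have he : eᴴ * e = 1 := (isUnitaryRect_fromCols.1 hE).1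
  let w := x + e * y
  have hwx : wᴴ * x = (1 + ρ) • 1 := by
    simp only [w, conjTranspose_add, conjTranspose_mul, Matrix.add_mul]
    rw [hx, Matrix.mul_assoc, hxy, mul_dual_smul, hy, dual_add_smul, dual_one_smul]
  have hww : wᴴ * w = (2 * (1 + ρ)) • 1 := by
    have : wᴴ * (e * y) = (1 + ρ) • 1 := by
      simp only [w, conjTranspose_add, conjTranspose_mul, Matrix.add_mul]
      rw [← Matrix.mul_assoc, hxe, Matrix.mul_assoc, ← Matrix.mul_assoc eᴴ, he, Matrix.one_mul,
        dual_smul_mul, hy, dual_add_smul, dual_one_smul, add_comm]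
    simp only [w, Matrix.mul_add] at hwx this ⊢
    rw [hwx, this, ← dual_add_smul, two_mul]
  -- The Householder reflection in `w`; the coefficient `c = (1 + ρ)⁻¹` is `2 / (wᴴ * w)`.
  let H : Matrix ι ι DQ := 1 - c • (w * wᴴ)
  have hHH : Hᴴ = H := by
    simp [H, conjTranspose_dual_smul]
  have hH2 : H * H = 1 := by
    have : (w * wᴴ) * (w * wᴴ) = (2 * (1 + ρ)) • (w * wᴴ) := by
      rw [Matrix.mul_assoc, ← Matrix.mul_assoc wᴴ, hww, dual_smul_mul, Matrix.one_mul,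
        mul_dual_smul]
    simp only [H, Matrix.mul_sub, Matrix.sub_mul, Matrix.one_mul, Matrix.mul_one, dual_smul_mul,
      mul_dual_smul, this, dual_smul_smul]
    rw [show c * (c * (2 * (1 + ρ))) = (1 + ρ) * c * (c + c) by ring, hc, one_mul, dual_add_smul]
    abel
  have hHx : H * x = -(e * y) := by
    simp only [H, Matrix.sub_mul, Matrix.one_mul, dual_smul_mul, Matrix.mul_assoc, hwx,
      mul_dual_smul, dual_smul_smul, Matrix.mul_one]
    rw [mul_comm, hc, dual_one_smul]
    simp [w]
  have hH : H.IsUnitaryRect := ⟨by rw [hHH, hH2], by rw [hHH, hH2]⟩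
  refine ⟨_, H * E, ?_⟩
  -- As `H` sends `e` to `x` only up to the phase `-y`, this unitary factor corrects the first
  -- column.
  let D : Matrix (Unit ⊕ Fin (Fintype.card ι - 1)) (Unit ⊕ Fin (Fintype.card ι - 1)) DQ :=
    Matrix.fromBlocks (-y) 0 0 1
  have key : fromCols x (H * E) = H * fromCols e E * D := by
    rw [mul_fromCols, fromCols_mul_fromBlocks]
    simp only [Matrix.mul_zero, add_zero, zero_add, Matrix.mul_one, Matrix.mul_neg]
    rw [Matrix.mul_assoc, ← Matrix.mul_neg, ← hHx, ← Matrix.mul_assoc, hH2, Matrix.one_mul]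
  rw [key]
  exact (hH.mul hE).mul (IsUnitaryRect.fromBlocks ⟨by simp [hy], by simp [hy']⟩ .one)

end Matrix

/-! ### Singular pairs of dual quaternion matrices -/

/-- First order perturbation of an eigenvector: a pair of symmetric operators `T₀ ≠ 0`, `T₁`
has an eigenvector `y₀ + y₁ ε` of `T₀ + T₁ ε` with an eigenvalue `a₀ + a₁ ε`, `a₀ ≠ 0`. -/
lemma LinearMap.IsSymmetric.exists_dual_eigenvector {X : Type*} [NormedAddCommGroup X]
    [InnerProductSpace ℝ X] [FiniteDimensional ℝ X] {T₀ T₁ : X →ₗ[ℝ] X}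
    (h₀ : T₀.IsSymmetric) (h₁ : T₁.IsSymmetric) (hne : T₀ ≠ 0) :
    ∃ (a₀ a₁ : ℝ) (y₀ y₁ : X), a₀ ≠ 0 ∧ y₀ ≠ 0 ∧ T₀ y₀ = a₀ • y₀ ∧
      T₁ y₀ + T₀ y₁ = a₀ • y₁ + a₁ • y₀ := by
  obtain ⟨i, hi⟩ : ∃ i, h₀.eigenvalues rfl i ≠ 0 := by
    by_contra! h
    refine hne ((h₀.eigenvectorBasis rfl).toBasis.ext fun i => ?_)
    have := h₀.apply_eigenvectorBasis rfl i
    rw [h i] at this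
    simpa using this
  set a₀ := h₀.eigenvalues rfl i with ha₀
  set E := Module.End.eigenspace T₀ a₀ with hE
  have hEn : Nontrivial E := by
    refine ⟨⟨⟨h₀.eigenvectorBasis rfl i, ?_⟩, 0, ?_⟩⟩
    · rw [Module.End.mem_eigenspace_iff]
      exact h₀.apply_eigenvectorBasis rfl i
    · intro h
      have := congrArg Subtype.val h
      exact (h₀.eigenvectorBasis rfl).orthonormal.ne_zero i this
  -- Degenerate perturbation theory: `y₁` exists exactly when `a₁ • y₀ - T₁ y₀` is orthogonal to the
  -- whole eigenspace `E`, that is, when `y₀` is an eigenvector of the compression of `T₁` to `E`.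
  let S : E →ₗ[ℝ] E := E.orthogonalProjectionOnto.toLinearMap ∘ₗ T₁ ∘ₗ E.subtype
  have hS : S.IsSymmetric := fun x y => by
    have e1 : inner ℝ (S x) y = inner ℝ (T₁ x) (y : X) :=
      E.inner_orthogonalProjectionOnto_eq_of_mem_right y (T₁ x)
    have e2 : inner ℝ x (S y) = inner ℝ (x : X) (T₁ y) :=
      E.inner_orthogonalProjectionOnto_eq_of_mem_left x (T₁ y)
    rw [e1, e2, h₁]
  obtain ⟨a₁, ha₁⟩ : ∃ a₁ : ℝ, Module.End.HasEigenvalue S a₁ :=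
    ⟨_, hS.hasEigenvalue_iSup_of_finiteDimensional⟩
  obtain ⟨y₀, hy₀⟩ := ha₁.exists_hasEigenvector
  have hT₀y : T₀ y₀ = a₀ • (y₀ : X) := Module.End.mem_eigenspace_iff.1 y₀.2
  have hSy : S y₀ = a₁ • y₀ := hy₀.apply_eq_smul
  let T : X →ₗ[ℝ] X := T₀ - a₀ • LinearMap.id
  have hT : T.IsSymmetric := fun x y => by
    simp only [T, LinearMap.sub_apply, LinearMap.smul_apply, LinearMap.id_apply, inner_sub_left,
      inner_sub_right, real_inner_smul_left, real_inner_smul_right, h₀ x y]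
  -- The range of the symmetric operator `T = T₀ - a₀` is the orthogonal complement of its kernel
  -- `E`.
  have hmem : a₁ • (y₀ : X) - T₁ y₀ ∈ LinearMap.range T := by
    rw [← Submodule.orthogonal_orthogonal (LinearMap.range T), hT.orthogonal_range,
      Submodule.mem_orthogonal]
    intro x hx
    have hx' : x ∈ E := by
      rw [hE, Module.End.mem_eigenspace_iff]
      simpa [T, sub_eq_zero] using hx
    have := E.inner_orthogonalProjectionOnto_eq_of_mem_left ⟨x, hx'⟩ (T₁ y₀)
    have h2 : inner ℝ (⟨x, hx'⟩ : E) (S y₀) = inner ℝ x (T₁ y₀) := this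
    rw [hSy, Submodule.coe_inner] at h2
    rw [inner_sub_right, ← h2]
    simp
  obtain ⟨y₁, hy₁⟩ := hmem
  refine ⟨a₀, a₁, y₀, y₁, hi, fun h => hy₀.2 (Subtype.ext h), hT₀y, ?_⟩
  simp only [T, LinearMap.sub_apply, LinearMap.smul_apply, LinearMap.id_apply] at hy₁
  rw [sub_eq_iff_eq_add.1 hy₁]
  abel

namespace Matrix

variable {ι κ : Type*} [Fintype ι] [Fintype κ]

/-- Left multiplication by a quaternion matrix, as a real linear operator. -/
noncomputable def quaternionLin (M : Matrix κ κ ℍ[ℝ]) :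
    PiLp 2 (fun _ : κ => ℍ[ℝ]) →ₗ[ℝ] PiLp 2 (fun _ : κ => ℍ[ℝ]) where
  toFun x := WithLp.toLp 2 (M *ᵥ WithLp.ofLp x)
  map_add' x y := by simp [mulVec_add]
  map_smul' c x := by simp [mulVec_smul]

lemma quaternionLin_apply (M : Matrix κ κ ℍ[ℝ]) (x : PiLp 2 (fun _ : κ => ℍ[ℝ])) (i : κ) :
    M.quaternionLin x i = ∑ j, M i j * x j := rfl

/-- The real inner product is the real part of a product, and real parts are invariant under cyclic
permutation, which makes up for the lack of commutativity. -/
lemma isSymmetric_quaternionLin {M : Matrix κ κ ℍ[ℝ]} (hM : Mᴴ = M) :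
    M.quaternionLin.IsSymmetric := by
  intro x y
  simp only [PiLp.inner_apply, quaternionLin_apply, Quaternion.inner_def, Finset.sum_mul,
    star_sum, Finset.mul_sum, star_mul]
  have hre : ∀ f : κ → ℍ[ℝ], (∑ i, f i).re = ∑ i, (f i).re := fun f =>
    map_sum (⟨⟨fun q : ℍ[ℝ] => q.re, rfl⟩, fun _ _ => rfl⟩ : ℍ[ℝ] →+ ℝ) f _
  simp only [hre]
  rw [Finset.sum_comm]
  refine Finset.sum_congr rfl fun j _ => Finset.sum_congr rfl fun i _ => ?_
  rw [← conjTranspose_apply, hM]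
  have hc : ∀ a b : ℍ[ℝ], (a * b).re = (b * a).re := fun a b => by
    simp only [Quaternion.re_mul]; ring
  rw [mul_assoc, hc (M i j), mul_assoc]

/-- A matrix with nonzero standard part has a singular pair with appreciable singular value. -/
lemma exists_singular_pair_of_fst_ne_zero (A : Matrix ι κ DQ) (hA : ∃ i k, (A i k).fst ≠ 0) :
    ∃ (x : Matrix ι Unit DQ) (y : Matrix κ Unit DQ) (μ : ℝ[ε]), 0 < μ.fst ∧
      xᴴ * x = 1 ∧ yᴴ * y = 1 ∧ A * y = μ • x ∧ Aᴴ * x = μ • y := by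
  set H := Aᴴ * A with hH
  have hHH : Hᴴ = H := by simp [hH]
  let H₀ : Matrix κ κ ℍ[ℝ] := H.map TrivSqZeroExt.fst
  let H₁ : Matrix κ κ ℍ[ℝ] := H.map TrivSqZeroExt.snd
  have h₀ : H₀ᴴ = H₀ := by
    ext1 i j
    exact congrArg TrivSqZeroExt.fst (congrFun (congrFun hHH i) j)
  have h₁ : H₁ᴴ = H₁ := by
    ext1 i j
    exact congrArg TrivSqZeroExt.snd (congrFun (congrFun hHH i) j)
  -- A diagonal entry of `H₀` is the sum of the squared norms of the standard parts in a column of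
  -- `A`.
  have hne : H₀.quaternionLin ≠ 0 := by
    obtain ⟨i, k, hik⟩ := hA
    intro h0
    classical
    have h1 : H₀ k k = 0 := by
      have := congrArg (fun f => f (WithLp.toLp 2 (Pi.single k 1)) k) h0
      simpa [quaternionLin_apply, Pi.single_apply] using this
    have h2 : H k k = dualToDQ (dualSqNorm fun i => A i k) := conjTranspose_mul_self_apply A k
    have h3 : ((dualSqNorm fun i => A i k).fst : ℍ[ℝ]) = 0 := by
      rw [← fst_dualToDQ, ← h2]
      exact h1
    exact hik (fst_eq_zero_of_dualSqNorm (Quaternion.coe_injective h3) i)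
  obtain ⟨a₀, a₁, y₀, y₁, ha₀, hy₀, e0, e1⟩ :=
    (isSymmetric_quaternionLin h₀).exists_dual_eigenvector (isSymmetric_quaternionLin h₁) hne
  -- The two real equations are the standard and infinitesimal parts of `H * z = a • z`.
  let z : Matrix κ Unit DQ := of fun k _ => ((y₀ k, y₁ k) : DQ)
  let a : ℝ[ε] := (a₀, a₁)
  have hz : H * z = a • z := by
    ext1 i j
    rw [Matrix.mul_apply, dual_smul_apply]
    ext1
    · have := congrArg (fun v => v i) e0
      simp only [quaternionLin_apply, PiLp.smul_apply] at this
      rw [TrivSqZeroExt.fst_sum, TrivSqZeroExt.fst_mul, fst_dualToDQ]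
      simp only [TrivSqZeroExt.fst_mul]
      change _ = (a₀ : ℍ[ℝ]) * y₀ i
      rw [Quaternion.coe_mul_eq_smul]
      exact this
    · have := congrArg (fun v => v i) e1
      simp only [quaternionLin_apply, PiLp.add_apply, PiLp.smul_apply] at this
      rw [TrivSqZeroExt.snd_sum, DualNumber.snd_mul, fst_dualToDQ, snd_dualToDQ]
      simp only [DualNumber.snd_mul, Finset.sum_add_distrib]
      change _ = (a₀ : ℍ[ℝ]) * y₁ i + (a₁ : ℍ[ℝ]) * y₀ i
      rw [Quaternion.coe_mul_eq_smul, Quaternion.coe_mul_eq_smul, ← this, add_comm]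
      rfl
  obtain ⟨k, hk⟩ : ∃ k, y₀ k ≠ 0 := by
    by_contra! h
    exact hy₀ (by ext1 k; exact h k)
  obtain ⟨ρ, hρ, hunit⟩ := exists_unit_smul z k hk
  set y := ρ • z with hy
  have hHy : H * y = a • y := by
    rw [hy, mul_dual_smul, hz, dual_smul_smul, dual_smul_smul, mul_comm]
  have hAy : (A * y)ᴴ * (A * y) = a • 1 := by
    rw [conjTranspose_mul, Matrix.mul_assoc, ← Matrix.mul_assoc Aᴴ, ← hH, hHy, mul_dual_smul,
      hunit]
  -- The eigenvalue is the squared norm of `A * y`, so its nonzero standard part is positive. The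
  -- pair is then `μ = √a` and `x = μ⁻¹ • (A * y)`.
  have hapos : 0 < a.fst := by
    refine lt_of_le_of_ne ?_ ha₀.symm
    have h := congrFun (congrFun hAy ()) ()
    rw [conjTranspose_mul_self_apply, dual_smul_apply, one_apply_eq, mul_one] at h
    rw [← dualToDQ_injective h]
    exact fst_dualSqNorm_nonneg _
  obtain ⟨μ, hμ, hμ0⟩ := exists_dual_sqrt a hapos
  obtain ⟨c, hc, hc0⟩ := exists_dual_inv μ hμ0.ne'
  refine ⟨c • (A * y), y, μ, hμ0, ?_, hunit, ?_, ?_⟩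
  · rw [conjTranspose_dual_smul, dual_smul_mul, mul_dual_smul, hAy, dual_smul_smul, dual_smul_smul,
      ← hμ, show c * c * (μ * μ) = (μ * c) * (μ * c) by ring, hc, mul_one, dual_one_smul]
  · rw [dual_smul_smul, hc, dual_one_smul]
  · rw [mul_dual_smul, ← Matrix.mul_assoc, ← hH, hHy, dual_smul_smul, ← hμ,
      show c * (μ * μ) = (μ * c) * μ by ring, hc, one_mul]

/-- A nonzero matrix has a singular pair with positive singular value. -/
lemma exists_singular_pair (A : Matrix ι κ DQ) (hA : A ≠ 0) :
    ∃ (x : Matrix ι Unit DQ) (y : Matrix κ Unit DQ) (μ : ℝ[ε]), DualLT 0 μ ∧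
      xᴴ * x = 1 ∧ yᴴ * y = 1 ∧ A * y = μ • x ∧ Aᴴ * x = μ • y := by
  by_cases h : ∃ i k, (A i k).fst ≠ 0
  · obtain ⟨x, y, μ, h0, h⟩ := A.exists_singular_pair_of_fst_ne_zero h
    exact ⟨x, y, μ, Or.inl h0, h⟩
  push Not at h
  -- With vanishing standard part, `A = ε A'` for a standard matrix `A'`; a singular value `μ` of
  -- `A'` becomes the positive infinitesimal `ε μ`.
  let A' : Matrix ι κ DQ := of fun i k => TrivSqZeroExt.inl (A i k).snd
  let e : ℝ[ε] := TrivSqZeroExt.inr 1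
  have hA' : A = e • A' := by
    ext1 i k
    rw [dual_smul_apply]
    ext1
    · simp [e, h]
    · simp [e, A']
  obtain ⟨x, y, μ, h0, hx, hy, h1, h2⟩ := A'.exists_singular_pair_of_fst_ne_zero (by
    by_contra! hc
    refine hA ?_
    ext1 i k
    ext1
    · exact h i k
    · exact hc i k)
  refine ⟨x, y, e * μ, Or.inr ⟨by simp [e], by simpa [e] using h0⟩, hx, hy, ?_, ?_⟩
  · rw [hA', dual_smul_mul, h1, dual_smul_smul]
  · rw [hA', conjTranspose_dual_smul, dual_smul_mul, h2, dual_smul_smul]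

end Matrix

/-! ### Singular value decompositions -/

/-- The lexicographic key of a dual number. -/
def dualLex (x : ℝ[ε]) : ℝ ×ₗ ℝ := toLex (x.fst, x.snd)

lemma dualLE_iff (x y : ℝ[ε]) : DualLE x y ↔ dualLex x ≤ dualLex y := by
  rw [dualLex, dualLex, Prod.Lex.toLex_le_toLex, DualLE, DualLT]
  constructor
  · rintro ((h | ⟨h, h'⟩) | rfl)
    · exact Or.inl h
    · exact Or.inr ⟨h, h'.le⟩
    · exact Or.inr ⟨rfl, le_rfl⟩
  · rintro (h | ⟨h, h'⟩)
    · exact Or.inl (Or.inl h)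
    · rcases h'.lt_or_eq with h' | h'
      · exact Or.inl (Or.inr ⟨h, h'⟩)
      · exact Or.inr (TrivSqZeroExt.ext h h')

lemma exists_equiv_fin_antitone {τ L : Type*} [Fintype τ] [LinearOrder L] (f : τ → L) {k : ℕ}
    (hk : Fintype.card τ = k) : ∃ e : Fin k ≃ τ, Antitone (f ∘ e) := by
  let g := (Fintype.equivFinOfCardEq hk).symm
  refine ⟨(Tuple.sort (OrderDual.toDual ∘ f ∘ g)).trans g, ?_⟩
  exact Tuple.monotone_sort (OrderDual.toDual ∘ f ∘ g)

namespace Matrix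

/-- Deflation: completing a singular pair to unitary matrices splits off a `1 × 1` block, and
induction treats the rest. The values appear in no prescribed order and are sorted in `exists_svd`.
-/
lemma exists_svd_of_card (N : ℕ) : ∀ (ι κ : Type) [Fintype ι] [Fintype κ] [DecidableEq ι]
    [DecidableEq κ] (A : Matrix ι κ DQ), Fintype.card ι = N →
    ∃ (t a b : ℕ) (U : Matrix ι (Fin t ⊕ Fin a) DQ) (V : Matrix κ (Fin t ⊕ Fin b) DQ)
      (μ : Fin t → ℝ[ε]), U.IsUnitaryRect ∧ V.IsUnitaryRect ∧ (∀ i, DualLT 0 (μ i)) ∧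
      Uᴴ * A * V = fromBlocks (diagonal fun i => dualToDQ (μ i)) 0 0 0 := by
  have hzero : ∀ (ι κ : Type) [Fintype ι] [Fintype κ] [DecidableEq ι] [DecidableEq κ],
      ∃ (t a b : ℕ) (U : Matrix ι (Fin t ⊕ Fin a) DQ) (V : Matrix κ (Fin t ⊕ Fin b) DQ)
        (μ : Fin t → ℝ[ε]), U.IsUnitaryRect ∧ V.IsUnitaryRect ∧ (∀ i, DualLT 0 (μ i)) ∧
        Uᴴ * (0 : Matrix ι κ DQ) * V = fromBlocks (diagonal fun i => dualToDQ (μ i)) 0 0 0 := by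
    intro ι κ _ _ _ _
    let e : Fin 0 ⊕ Fin (Fintype.card ι) ≃ ι := Fintype.equivOfCardEq (by simp)
    let f : Fin 0 ⊕ Fin (Fintype.card κ) ≃ κ := Fintype.equivOfCardEq (by simp)
    refine ⟨0, _, _, (1 : Matrix ι ι DQ).submatrix (Equiv.refl ι) e,
      (1 : Matrix κ κ DQ).submatrix (Equiv.refl κ) f, fun i => i.elim0,
      IsUnitaryRect.one.submatrix _ _, IsUnitaryRect.one.submatrix _ _, fun i => i.elim0, ?_⟩
    rw [Matrix.mul_zero, Matrix.zero_mul]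
    ext1 (i | i) (k | k)
    · exact i.elim0
    · exact i.elim0
    · exact k.elim0
    · rfl
  induction N with
  | zero =>
    intro ι κ _ _ _ _ A h
    have : IsEmpty ι := Fintype.card_eq_zero_iff.1 h
    rw [show A = 0 from Subsingleton.elim _ _]
    exact hzero ι κ
  | succ N ih =>
    intro ι κ _ _ _ _ A h
    by_cases hA : A = 0
    · rw [hA]
      exact hzero ι κ
    obtain ⟨x, y, ν, hν, hx, hy, h1, h2⟩ := A.exists_singular_pair hA
    obtain ⟨k, X, hX⟩ := exists_unitary_first_column x hx
    obtain ⟨k', Y, hY⟩ := exists_unitary_first_column y hy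
    have hcard : Fintype.card (Fin k) = N := by
      have := hX.card_eq
      simp only [Fintype.card_sum, Fintype.card_unit, Fintype.card_fin] at this ⊢
      omega
    obtain ⟨t, a, b, U, V, μ, hU, hV, hμ, hUV⟩ := ih (Fin k) (Fin k') (Xᴴ * A * Y) hcard
    let g : Fin (t + 1) ≃ Unit ⊕ Fin t := Fintype.equivOfCardEq (by simp [add_comm])
    let f (c : ℕ) : Fin (t + 1) ⊕ Fin c ≃ Unit ⊕ (Fin t ⊕ Fin c) :=
      (g.sumCongr (Equiv.refl _)).trans (Equiv.sumAssoc _ _ _)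
    -- The off-diagonal blocks vanish because `A * y` is a multiple of `x` and `Aᴴ * x` is a
    -- multiple of `y`.
    have hblock : (fromCols x X)ᴴ * A * fromCols y Y =
        fromBlocks (ν • (1 : Matrix Unit Unit DQ)) 0 0 (Xᴴ * A * Y) := by
      rw [isUnitaryRect_fromCols] at hX hY
      have h3 : xᴴ * A = ν • yᴴ := by
        rw [← conjTranspose_dual_smul, ← h2, conjTranspose_mul, conjTranspose_conjTranspose]
      rw [conjTranspose_fromCols_eq_fromRows_conjTranspose, Matrix.mul_assoc, mul_fromCols,
        fromRows_mul_fromCols, fromBlocks_inj]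
      refine ⟨?_, ?_, ?_, (Matrix.mul_assoc _ _ _).symm⟩
      · rw [h1, mul_dual_smul, hx]
      · rw [← Matrix.mul_assoc, h3, dual_smul_mul, hY.2.1, dual_smul_zero]
      · rw [h1, mul_dual_smul, hX.2.2.1, dual_smul_zero]
    refine ⟨t + 1, a, b,
      (fromCols x X * Matrix.fromBlocks (1 : Matrix Unit Unit DQ) 0 0 U).submatrix
        (Equiv.refl ι) (f a),
      (fromCols y Y * Matrix.fromBlocks (1 : Matrix Unit Unit DQ) 0 0 V).submatrix
        (Equiv.refl κ) (f b),
      fun i => Sum.elim (fun _ => ν) μ (g i),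
      (hX.mul (.fromBlocks .one hU)).submatrix _ _, (hY.mul (.fromBlocks .one hV)).submatrix _ _,
      ?_, ?_⟩
    · intro i
      dsimp only
      rcases g i with j | j
      · exact hν
      · exact hμ j
    · have key : (fromCols x X * Matrix.fromBlocks (1 : Matrix Unit Unit DQ) 0 0 U)ᴴ * A *
          (fromCols y Y * Matrix.fromBlocks (1 : Matrix Unit Unit DQ) 0 0 V) =
          fromBlocks (ν • (1 : Matrix Unit Unit DQ)) 0 0
            (fromBlocks (diagonal fun i => dualToDQ (μ i)) 0 0 0) := by
        calc _ = (Matrix.fromBlocks (1 : Matrix Unit Unit DQ) 0 0 U)ᴴ *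
              ((fromCols x X)ᴴ * A * fromCols y Y) *
              Matrix.fromBlocks (1 : Matrix Unit Unit DQ) 0 0 V := by
              simp only [conjTranspose_mul, Matrix.mul_assoc]
          _ = _ := by
              rw [hblock, fromBlocks_conjTranspose, fromBlocks_multiply, fromBlocks_multiply]
              simp [hUV]
      rw [conj_submatrix, key]
      have hg : ∀ i j, diagonal (fun i => dualToDQ (Sum.elim (fun _ => ν) μ (g i))) i j =
          diagonal (fun s => dualToDQ (Sum.elim (fun _ => ν) μ s)) (g i) (g j) := fun i j => by
        simp [diagonal_apply]
      ext1 (i | i) (k | k)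
      · rw [fromBlocks_apply₁₁, hg]
        simp only [submatrix_apply, f, Equiv.trans_apply, Equiv.sumCongr_apply, Sum.map_inl]
        rcases g i with i | i <;> rcases g k with k | k
        · change dualToDQ ν * (1 : Matrix Unit Unit DQ) i k = _
          simp
        · simp
        · simp
        · simp [diagonal_apply]
      · simp only [submatrix_apply, f, Equiv.trans_apply, Equiv.sumCongr_apply, Sum.map_inl]
        rcases g i with i | i <;> simp
      · simp only [submatrix_apply, f, Equiv.trans_apply, Equiv.sumCongr_apply, Sum.map_inl]
        rcases g k with k | k <;> simp
      · simp [f]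

variable {ι κ : Type} [Fintype ι] [Fintype κ] [DecidableEq ι] [DecidableEq κ]

/-- Every dual quaternion matrix has a singular value decomposition with ordered singular
values. -/
theorem exists_svd (A : Matrix ι κ DQ) :
    ∃ (t a b : ℕ) (U : Matrix ι (Fin t ⊕ Fin a) DQ) (V : Matrix κ (Fin t ⊕ Fin b) DQ)
      (μ : Fin t → ℝ[ε]), U.IsUnitaryRect ∧ V.IsUnitaryRect ∧ (∀ i, DualLT 0 (μ i)) ∧
      (∀ i j, i ≤ j → DualLE (μ j) (μ i)) ∧
      Uᴴ * A * V = fromBlocks (diagonal fun i => dualToDQ (μ i)) 0 0 0 := by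
  obtain ⟨t, a, b, U, V, μ, hU, hV, hμ, h⟩ := exists_svd_of_card _ ι κ A rfl
  obtain ⟨e, he⟩ := exists_equiv_fin_antitone (fun i => dualLex (μ i)) (Fintype.card_fin t)
  refine ⟨t, a, b, U.submatrix (Equiv.refl ι) (e.sumCongr (Equiv.refl _)),
    V.submatrix (Equiv.refl κ) (e.sumCongr (Equiv.refl _)), μ ∘ e, hU.submatrix _ _,
    hV.submatrix _ _, fun i => hμ (e i), fun i j hij => (dualLE_iff _ _).2 (he hij), ?_⟩
  rw [conj_submatrix, h]
  ext1 (i | i) (k | k) <;> simp [diagonal_apply]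

/-- Orthonormal columns can be completed to a unitary matrix. -/
theorem exists_unitary_fromCols (P : Matrix ι κ DQ) (hP : Pᴴ * P = 1) :
    ∃ (k : ℕ) (X : Matrix ι (Fin k) DQ), (fromCols P X).IsUnitaryRect := by
  obtain ⟨t, a, b, U, V, μ, hU, hV, -, -, h⟩ := P.exists_svd
  set D : Matrix (Fin t) (Fin t) DQ := diagonal fun i => dualToDQ (μ i) with hD
  have hDD : Dᴴ = D := by
    rw [hD, diagonal_conjTranspose]
    congr 1
    funext i
    exact star_dualToDQ _
  set F : Matrix (Fin t ⊕ Fin a) (Fin t ⊕ Fin b) DQ := fromBlocks D 0 0 0 with hF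
  have hPF : P = U * F * Vᴴ := by
    rw [← h]
    simp only [Matrix.mul_assoc, hV.2, Matrix.mul_one]
    rw [hU.mul_cancel_left']
  have hFF : Fᴴ * F = 1 := by
    rw [← h, conjTranspose_mul, conjTranspose_mul, conjTranspose_conjTranspose]
    simp only [Matrix.mul_assoc, hU.mul_cancel_left']
    rw [← Matrix.mul_assoc Pᴴ, hP, Matrix.one_mul, hV.1]
  -- All singular values of `P` square to one, so `F * Fᴴ` projects onto the first `t` coordinates
  -- and `J` supplies the remaining ones.
  have hD1 : D * D = 1 := by
    rw [hF, fromBlocks_conjTranspose, fromBlocks_multiply, ← fromBlocks_one, fromBlocks_inj] at hFF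
    simpa [hDD] using hFF.1
  let J : Matrix (Fin t ⊕ Fin a) (Fin a) DQ := fromRows 0 1
  have hJF : Jᴴ * F = 0 := by
    simp only [J, hF]
    rw [conjTranspose_fromRows_eq_fromCols_conjTranspose, fromCols_mul_fromBlocks]
    simp
  have hJJ : F * Fᴴ + J * Jᴴ = 1 := by
    simp only [J, hF]
    rw [conjTranspose_fromRows_eq_fromCols_conjTranspose, fromRows_mul_fromCols,
      fromBlocks_conjTranspose, fromBlocks_multiply, fromBlocks_add]
    simp [hDD, hD1]
  have hJ : Jᴴ * J = 1 := by
    simp only [J]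
    rw [conjTranspose_fromRows_eq_fromCols_conjTranspose, fromCols_mul_fromRows]
    simp
  have hJP : (U * J)ᴴ * P = 0 := by
    rw [hPF, conjTranspose_mul]
    simp only [Matrix.mul_assoc]
    rw [hU.mul_cancel_left, ← Matrix.mul_assoc, hJF, Matrix.zero_mul]
  refine ⟨a, U * J, isUnitaryRect_fromCols.2 ⟨hP, ?_, hJP, ?_, ?_⟩⟩
  · rw [← conjTranspose_conjTranspose (Pᴴ * (U * J)), conjTranspose_mul,
      conjTranspose_conjTranspose, hJP, conjTranspose_zero]
  · rw [conjTranspose_mul, Matrix.mul_assoc, hU.mul_cancel_left, hJ]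
  · have h1 : P * Pᴴ = U * (F * Fᴴ) * Uᴴ := by
      rw [hPF]
      simp only [conjTranspose_mul, conjTranspose_conjTranspose, Matrix.mul_assoc]
      rw [hV.mul_cancel_left]
    rw [h1, conjTranspose_mul, Matrix.mul_assoc U J, ← Matrix.mul_assoc J,
      ← Matrix.mul_assoc U (J * Jᴴ), ← Matrix.add_mul, ← Matrix.mul_add, hJJ, Matrix.mul_one, hU.2]

end Matrix

/-! ### The CS decomposition -/

namespace Matrix

lemma fst_mul_mul_eq_zero {α β γ δ : Type*} [Fintype β] [Fintype γ] (A : Matrix α β DQ)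
    {M : Matrix β γ DQ} (hM : ∀ i k, (M i k).fst = 0) (B : Matrix γ δ DQ) (i : α) (k : δ) :
    ((A * M * B) i k).fst = 0 := by
  simp [Matrix.mul_apply, TrivSqZeroExt.fst_sum, hM]

/-- The diagonal of the Gram matrix consists of squared column norms. Nothing more than
infinitesimality can follow, since `ε² = 0`. -/
lemma fst_eq_zero_of_conjTranspose_mul_self {α β : Type*} [Fintype α] {Y : Matrix α β DQ}
    (h : Yᴴ * Y = 0) (i : α) (k : β) : (Y i k).fst = 0 := by
  have h1 := conjTranspose_mul_self_apply Y k
  rw [h, zero_apply, ← dualToDQ_zero] at h1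
  refine fst_eq_zero_of_dualSqNorm (x := fun i => Y i k) ?_ i
  rw [← dualToDQ_injective h1, TrivSqZeroExt.fst_zero]

/-- Diagonalizing the first diagonal block refines the block partition and leaves the other block
alone. Both halves of the CS decomposition use this. -/
lemma conj_fromBlocks_submatrix_sumAssoc {α β ρ υ ζ J J' : Type*} [Fintype α] [Fintype β]
    [Fintype J] [Fintype J'] [DecidableEq J] [DecidableEq J']
    (U : Matrix α (ρ ⊕ ζ) DQ) (V : Matrix β (ρ ⊕ υ) DQ) (M : Matrix α β DQ) (S : Matrix J J' DQ)
    (A : Matrix ρ ρ DQ) (B : Matrix ζ υ DQ) (h : Uᴴ * M * V = fromBlocks A 0 0 B) :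
    ((fromBlocks U 0 0 (1 : Matrix J J DQ)).submatrix (Equiv.refl _)
        (Equiv.sumAssoc ρ ζ J).symm)ᴴ * fromBlocks M 0 0 S *
      (fromBlocks V 0 0 (1 : Matrix J' J' DQ)).submatrix (Equiv.refl _)
        (Equiv.sumAssoc ρ υ J').symm =
      fromBlocks A 0 0 (fromBlocks B 0 0 S) := by
  rw [conj_submatrix, fromBlocks_conjTranspose, fromBlocks_multiply, fromBlocks_multiply]
  simp only [conjTranspose_zero, Matrix.zero_mul, Matrix.mul_zero, add_zero, zero_add,
    conjTranspose_one, Matrix.one_mul, Matrix.mul_one, h]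
  ext1 (i | i | i) (k | k | k) <;> rfl

variable {ι ι₁ ι₂ κ α J : Type} [Fintype ι] [Fintype ι₁] [Fintype ι₂] [Fintype κ] [Fintype α]
  [Fintype J] [DecidableEq ι] [DecidableEq ι₁] [DecidableEq ι₂] [DecidableEq κ] [DecidableEq α]
  [DecidableEq J]

/-- The lower half of the CS decomposition. -/
lemma exists_unitary_of_gram_eq (Y : Matrix ι (α ⊕ J) DQ) (S T : Matrix J J DQ)
    (hS : Sᴴ = S) (hST : S * T = 1) (hTS : T * S = 1) (hY : Yᴴ * Y = fromBlocks 0 0 0 (S * S)) :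
    ∃ (r u z : ℕ) (σ : Fin r → ℝ) (U : Matrix ι (Fin r ⊕ (Fin z ⊕ J)) DQ)
      (V : Matrix α (Fin r ⊕ Fin u) DQ), U.IsUnitaryRect ∧ V.IsUnitaryRect ∧
      (∀ i, 0 < σ i) ∧ Antitone σ ∧
      Uᴴ * Y * (fromBlocks V 0 0 (1 : Matrix J J DQ)).submatrix (Equiv.refl _)
        (Equiv.sumAssoc _ _ _).symm =
        fromBlocks (diagonal fun i => realEps (σ i)) 0 0 (fromBlocks 0 0 0 S) := by
  obtain ⟨Y₁, Y₂, rfl⟩ : ∃ Y₁ Y₂, Y = fromCols Y₁ Y₂ := ⟨_, _, (fromCols_toCols Y).symm⟩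
  rw [conjTranspose_fromCols_eq_fromRows_conjTranspose, fromRows_mul_fromCols,
    fromBlocks_inj] at hY
  obtain ⟨h11, h12, h21, h22⟩ := hY
  have hT : Tᴴ = T := by
    have : Tᴴ * S = 1 := by
      rw [← hS, ← conjTranspose_mul, hST, conjTranspose_one]
    rw [← Matrix.mul_one Tᴴ, ← hST, ← Matrix.mul_assoc, this, Matrix.one_mul]
  have hZS : Y₂ * T * S = Y₂ := by rw [Matrix.mul_assoc, hTS, Matrix.mul_one]
  -- Dividing `Y₂` by the invertible `S` makes its columns orthonormal, so they extend to a unitary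
  -- basis.
  have hZ : (Y₂ * T)ᴴ * (Y₂ * T) = 1 := by
    rw [conjTranspose_mul, Matrix.mul_assoc, ← Matrix.mul_assoc Y₂ᴴ, h22, hT, Matrix.mul_assoc S,
      hST, Matrix.mul_one, hTS]
  obtain ⟨k, X, hX⟩ := exists_unitary_fromCols (Y₂ * T) hZ
  obtain ⟨-, hZX, hXZ, hXX, hsum⟩ := isUnitaryRect_fromCols.1 hX
  have hG : (fromCols X (Y₂ * T)).IsUnitaryRect :=
    isUnitaryRect_fromCols.2 ⟨hXX, hXZ, hZX, hZ, by rw [add_comm, hsum]⟩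
  -- The remaining columns `Y₁` have zero Gram matrix, hence are infinitesimal but possibly nonzero.
  -- All singular values of `Xᴴ * Y₁` are therefore infinitesimal; they form `Σ ε`.
  obtain ⟨r, z, u, U, V, μ, hU, hV, hμ, hanti, hUV⟩ := (Xᴴ * Y₁).exists_svd
  have hfst : ∀ i, (μ i).fst = 0 := by
    intro i
    have h1 : ∀ i k, ((Xᴴ * Y₁) i k).fst = 0 := fun i k => by
      simp [Matrix.mul_apply, TrivSqZeroExt.fst_sum, fst_eq_zero_of_conjTranspose_mul_self h11]
    have h2 := fst_mul_mul_eq_zero Uᴴ h1 V (Sum.inl i) (Sum.inl i)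
    rw [hUV, fromBlocks_apply₁₁, diagonal_apply_eq, fst_dualToDQ] at h2
    exact Quaternion.coe_injective h2
  have hμr : ∀ i, dualToDQ (μ i) = realEps (μ i).snd := fun i => by
    rw [realEps_eq_dualToDQ]
    congr 1
    exact TrivSqZeroExt.ext (by simp [hfst]) (by simp)
  refine ⟨r, u, z, fun i => (μ i).snd,
    fromCols X (Y₂ * T) * (fromBlocks U 0 0 (1 : Matrix J J DQ)).submatrix (Equiv.refl _)
      (Equiv.sumAssoc _ _ _).symm, V,
    hG.mul ((IsUnitaryRect.fromBlocks hU .one).submatrix _ _), hV, ?_, ?_, ?_⟩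
  · intro i
    rcases hμ i with h | h
    · rw [hfst] at h
      exact absurd h (lt_irrefl _)
    · exact h.2
  · intro i j hij
    rcases hanti i j hij with (h | h) | h
    · rw [hfst, hfst] at h
      exact absurd h (lt_irrefl _)
    · exact h.2.le
    · exact (congrArg TrivSqZeroExt.snd h).le
  · have hGY : (fromCols X (Y₂ * T))ᴴ * fromCols Y₁ Y₂ = fromBlocks (Xᴴ * Y₁) 0 0 S := by
      rw [conjTranspose_fromCols_eq_fromRows_conjTranspose, fromRows_mul_fromCols, fromBlocks_inj]
      refine ⟨rfl, ?_, ?_, ?_⟩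
      · rw [← hZS, ← Matrix.mul_assoc, hXZ, Matrix.zero_mul]
      · rw [conjTranspose_mul, Matrix.mul_assoc, h21, Matrix.mul_zero]
      · conv_lhs => rw [← hZS]
        rw [← Matrix.mul_assoc, hZS, hZ, Matrix.one_mul]
    rw [conjTranspose_mul, Matrix.mul_assoc _ (fromCols X (Y₂ * T))ᴴ, hGY,
      conj_fromBlocks_submatrix_sumAssoc U V _ _ _ _ hUV]
    simp only [hμr]

/-- The singular value decomposition of a contraction: its singular values are `1`, appreciable
and less than one, or infinitesimal. -/
lemma exists_svd_of_contraction {ι₂ : Type} [Fintype ι₂] (W₁ : Matrix ι₁ κ DQ) (W₂ : Matrix ι₂ κ DQ)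
    (h : W₁ᴴ * W₁ + W₂ᴴ * W₂ = 1) :
    ∃ (a j t v w : ℕ) (c : Fin j → ℝ[ε]) (d : Fin t → ℝ)
      (U : Matrix ι₁ (Fin a ⊕ (Fin j ⊕ (Fin t ⊕ Fin v))) DQ)
      (V : Matrix κ (Fin a ⊕ (Fin j ⊕ (Fin t ⊕ Fin w))) DQ),
      U.IsUnitaryRect ∧ V.IsUnitaryRect ∧ (∀ i, 0 < (c i).fst ∧ (c i).fst < 1) ∧
      (∀ i k, i ≤ k → DualLE (c k) (c i)) ∧ (∀ i, 0 < d i) ∧ Antitone d ∧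
      Uᴴ * W₁ * V = fromBlocks 1 0 0 (fromBlocks (diagonal fun i => dualToDQ (c i)) 0 0
        (fromBlocks (diagonal fun i => realEps (d i)) 0 0 0)) := by
  obtain ⟨T, v, w, U, V, μ, hU, hV, hμ, hanti, hUV⟩ := W₁.exists_svd
  have hnn : ∀ i, 0 ≤ (μ i).fst := fun i => by
    rcases hμ i with h | h
    · exact h.le
    · exact h.1.le
  have hgram : (W₂ * V)ᴴ * (W₂ * V) =
      1 - fromBlocks (diagonal fun i => dualToDQ (μ i * μ i)) 0 0 0 := by
    have h1 : (Uᴴ * W₁ * V)ᴴ * (Uᴴ * W₁ * V) = Vᴴ * (W₁ᴴ * W₁) * V := by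
      simp only [conjTranspose_mul, conjTranspose_conjTranspose, Matrix.mul_assoc,
        hU.mul_cancel_left']
    have h2 : (W₂ * V)ᴴ * (W₂ * V) = Vᴴ * (W₂ᴴ * W₂) * V := by
      simp only [conjTranspose_mul, Matrix.mul_assoc]
    rw [h2, eq_sub_of_add_eq' h, Matrix.mul_sub, Matrix.sub_mul, ← h1, Matrix.mul_one, hV.1, hUV,
      fromBlocks_conjTranspose, fromBlocks_multiply]
    congr 1
    simp [diagonal_conjTranspose, dualToDQ_mul, Pi.star_def]
  -- `N` is the squared norm of a column of `W₂ * V`. Its nonnegative standard part bounds `μ` by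
  -- one, and its vanishing when the standard part does excludes `1 + b ε` with `b ≠ 0`.
  have hN : ∀ i, ∃ N : ℝ[ε], 0 ≤ N.fst ∧ (N.fst = 0 → N = 0) ∧ N = 1 - μ i * μ i := fun i => by
    refine ⟨dualSqNorm fun k => (W₂ * V) k (Sum.inl i), fst_dualSqNorm_nonneg _,
      dualSqNorm_eq_zero, dualToDQ_injective ?_⟩
    rw [← conjTranspose_mul_self_apply, hgram, sub_apply, fromBlocks_apply₁₁, diagonal_apply_eq,
      one_apply_eq, sub_eq_iff_eq_add, ← dualToDQ_add, sub_add_cancel, dualToDQ_one]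
  have hle : ∀ i, (μ i).fst ≤ 1 := fun i => by
    obtain ⟨N, h0, -, h2⟩ := hN i
    rw [h2, TrivSqZeroExt.fst_sub, TrivSqZeroExt.fst_one, TrivSqZeroExt.fst_mul] at h0
    nlinarith [hnn i]
  have hone : ∀ i, (μ i).fst = 1 → μ i = 1 := fun i hi => by
    obtain ⟨N, -, h1, h2⟩ := hN i
    have h3 : N = 0 := h1 (by rw [h2]; simp [hi])
    rw [h3] at h2
    have h4 := congrArg TrivSqZeroExt.snd h2
    rw [TrivSqZeroExt.snd_sub, TrivSqZeroExt.snd_one, DualNumber.snd_mul, hi,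
      TrivSqZeroExt.snd_zero] at h4
    exact TrivSqZeroExt.ext (by rw [hi, TrivSqZeroExt.fst_one])
      (by rw [TrivSqZeroExt.snd_one]; linarith)
  -- The singular values fall into three classes by standard part: equal to one, strictly between
  -- zero and one, and zero. The last two are sorted separately.
  let p : Fin T → Prop := fun i => (μ i).fst = 1
  let p' : {i // ¬ p i} → Prop := fun i => (μ i).fst ≠ 0
  classical
  let e₁ : Fin (Fintype.card {i // p i}) ≃ {i // p i} := (Fintype.equivFin _).symm
  obtain ⟨e₂, he₂⟩ := exists_equiv_fin_antitone (fun i : {i // p' i} => dualLex (μ i)) rfl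
  obtain ⟨e₃, he₃⟩ := exists_equiv_fin_antitone (fun i : {i // ¬ p' i} => (μ i).snd) rfl
  let θ : Fin (Fintype.card {i // p i}) ⊕ (Fin (Fintype.card {i // p' i}) ⊕
      Fin (Fintype.card {i // ¬ p' i})) ≃ Fin T :=
    (e₁.sumCongr ((e₂.sumCongr e₃).trans (Equiv.sumCompl p'))).trans (Equiv.sumCompl p)
  let Θ (b : ℕ) : Fin (Fintype.card {i // p i}) ⊕ (Fin (Fintype.card {i // p' i}) ⊕
      (Fin (Fintype.card {i // ¬ p' i}) ⊕ Fin b)) ≃ Fin T ⊕ Fin b :=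
    (((Equiv.refl _).sumCongr (Equiv.sumAssoc _ _ _).symm).trans
      (Equiv.sumAssoc _ _ _).symm).trans (θ.sumCongr (Equiv.refl _))
  have hfst3 : ∀ i, (μ (e₃ i)).fst = 0 := fun i => not_not.1 (e₃ i).2
  refine ⟨_, _, _, v, w, fun i => μ (e₂ i), fun i => (μ (e₃ i)).snd,
    U.submatrix (Equiv.refl _) (Θ v), V.submatrix (Equiv.refl _) (Θ w), hU.submatrix _ _,
    hV.submatrix _ _, ?_, fun i k hik => (dualLE_iff _ _).2 (he₂ hik), ?_, he₃, ?_⟩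
  · intro i
    exact ⟨lt_of_le_of_ne (hnn _) (Ne.symm (e₂ i).2), lt_of_le_of_ne (hle _) (e₂ i).1.2⟩
  · intro i
    rcases hμ (e₃ i) with h | h
    · rw [hfst3] at h
      exact absurd h (lt_irrefl _)
    · exact h.2
  · have hθ : ∀ x y, diagonal (fun i => dualToDQ (μ i)) (θ x) (θ y) =
        diagonal (fun x => dualToDQ (μ (θ x))) x y := fun x y => by
      simp [diagonal_apply]
    have h1 : ∀ i, dualToDQ (μ (θ (Sum.inl i))) = 1 := fun i => by
      rw [show μ (θ (Sum.inl i)) = 1 from hone _ (e₁ i).2, dualToDQ_one]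
    have h3 : ∀ i, dualToDQ (μ (θ (Sum.inr (Sum.inr i)))) = realEps (μ (e₃ i)).snd := fun i => by
      rw [realEps_eq_dualToDQ]
      congr 1
      exact TrivSqZeroExt.ext (by rw [TrivSqZeroExt.fst_inr]; exact hfst3 i) rfl
    rw [conj_submatrix, hUV]
    ext1 (i | i | i | i) (k | k | k | k)
    all_goals
      first
      | rfl
      | (refine (hθ _ _).trans ?_
         simp [diagonal_apply, Matrix.one_apply, h1, h3])
    rfl

/-- The CS decomposition of a dual quaternion matrix with orthonormal columns. -/
theorem exists_cs_decomposition (W₁ : Matrix ι₁ κ DQ) (W₂ : Matrix ι₂ κ DQ)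
    (h : W₁ᴴ * W₁ + W₂ᴴ * W₂ = 1) :
    ∃ (r u j t v z w : ℕ) (σ : Fin r → ℝ) (c s : Fin j → ℝ[ε]) (d : Fin t → ℝ)
      (U₁ : Matrix ι₁ (Five r u j t v) DQ) (U₂ : Matrix ι₂ (Five r z j t w) DQ)
      (V : Matrix κ (Five r u j t w) DQ),
      U₁.IsUnitaryRect ∧ U₂.IsUnitaryRect ∧ V.IsUnitaryRect ∧
      (∀ a, 0 < σ a) ∧ Antitone σ ∧
      (∀ a, 0 < d a) ∧ Antitone d ∧
      (∀ a, DualAppreciable (c a) ∧ DualLT 0 (c a) ∧ DualLT (c a) 1) ∧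
      (∀ a b, a ≤ b → DualLE (c b) (c a)) ∧
      (∀ a, DualAppreciable (s a) ∧ DualLT 0 (s a) ∧ DualLT (s a) 1) ∧
      (∀ a b, a ≤ b → DualLE (s a) (s b)) ∧
      (∀ a, c a ^ 2 + s a ^ 2 = 1) ∧
      U₁ᴴ * W₁ * V = sigmaTop r u j t v w c d ∧
      U₂ᴴ * W₂ * V = sigmaBot r u z j t w σ s := by
  obtain ⟨a, j, t, v, w, c, d, U, V, hU, hV, hc, hcanti, hd, hdanti, hUV⟩ :=
    exists_svd_of_contraction W₁ W₂ h
  have hs : ∀ i, ∃ b : ℝ[ε], b * b = 1 - c i * c i ∧ 0 < b.fst := fun i =>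
    exists_dual_sqrt _ (by
      rw [TrivSqZeroExt.fst_sub, TrivSqZeroExt.fst_one, TrivSqZeroExt.fst_mul]
      nlinarith [hc i])
  choose s hss hspos using hs
  choose s' hs' _ using fun i => exists_dual_inv (s i) (hspos i).ne'
  -- The square root of the nonzero part of `1 - μ²`: infinitesimal and absent singular values both
  -- contribute exactly one.
  let S : Matrix (Fin j ⊕ (Fin t ⊕ Fin w)) (Fin j ⊕ (Fin t ⊕ Fin w)) DQ :=
    fromBlocks (diagonal fun i => dualToDQ (s i)) 0 0 (fromBlocks 1 0 0 1)
  let S' : Matrix (Fin j ⊕ (Fin t ⊕ Fin w)) (Fin j ⊕ (Fin t ⊕ Fin w)) DQ :=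
    fromBlocks (diagonal fun i => dualToDQ (s' i)) 0 0 (fromBlocks 1 0 0 1)
  have hS : Sᴴ = S := by
    simp [S, fromBlocks_conjTranspose, diagonal_conjTranspose, Pi.star_def]
  have hSS' : S * S' = 1 := by
    simp [S, S', fromBlocks_multiply, ← dualToDQ_mul, hs']
  have hS'S : S' * S = 1 := by
    simp [S, S', fromBlocks_multiply, ← dualToDQ_mul, mul_comm (s' _), hs']
  have hY : (W₂ * V)ᴴ * (W₂ * V) = fromBlocks 0 0 0 (S * S) := by
    have h1 : (Uᴴ * W₁ * V)ᴴ * (Uᴴ * W₁ * V) = Vᴴ * (W₁ᴴ * W₁) * V := by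
      simp only [conjTranspose_mul, conjTranspose_conjTranspose, Matrix.mul_assoc,
        hU.mul_cancel_left']
    have h2 : (W₂ * V)ᴴ * (W₂ * V) = Vᴴ * (W₂ᴴ * W₂) * V := by
      simp only [conjTranspose_mul, Matrix.mul_assoc]
    rw [h2, eq_sub_of_add_eq' h, Matrix.mul_sub, Matrix.sub_mul, ← h1, Matrix.mul_one, hV.1,
      sub_eq_iff_eq_add, hUV]
    simp only [fromBlocks_conjTranspose, fromBlocks_multiply, fromBlocks_add, S,
      diagonal_conjTranspose, diagonal_mul_diagonal, Pi.star_def, star_dualToDQ,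
      realEps_eq_dualToDQ, ← dualToDQ_mul, hss]
    simp [fromBlocks_add, ← dualToDQ_add]
  obtain ⟨r, u, z, σ, U₂, V', hU₂, hV', hσ, hσanti, hbot⟩ :=
    exists_unitary_of_gram_eq (W₂ * V) S S' hS hSS' hS'S hY
  -- The same `V'` is applied to both sides of the upper half, where it acts on an identity block:
  -- that block is preserved and merely splits into `I_r` and `I_u`.
  refine ⟨r, u, j, t, v, z, w, σ, c, s, d,
    U * (fromBlocks V' 0 0 (1 : Matrix _ _ DQ)).submatrix (Equiv.refl _)
      (Equiv.sumAssoc _ _ _).symm, U₂,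
    V * (fromBlocks V' 0 0 (1 : Matrix _ _ DQ)).submatrix (Equiv.refl _)
      (Equiv.sumAssoc _ _ _).symm,
    hU.mul ((IsUnitaryRect.fromBlocks hV' .one).submatrix _ _), hU₂,
    hV.mul ((IsUnitaryRect.fromBlocks hV' .one).submatrix _ _), hσ, hσanti, hd, hdanti,
    fun i => ⟨(hc i).1.ne', Or.inl (hc i).1, Or.inl (hc i).2⟩, hcanti, ?_, ?_, ?_, ?_, ?_⟩
  · intro i
    refine ⟨(hspos i).ne', Or.inl (hspos i), Or.inl ?_⟩
    have := congrArg TrivSqZeroExt.fst (hss i)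
    rw [TrivSqZeroExt.fst_sub, TrivSqZeroExt.fst_one, TrivSqZeroExt.fst_mul,
      TrivSqZeroExt.fst_mul] at this
    rw [TrivSqZeroExt.fst_one]
    nlinarith [hc i, hspos i]
  · intro i k hik
    -- The two parts of `s² = 1 - c²` reverse the lexicographic order: standard parts are compared
    -- first, and for equal ones the infinitesimal parts through `s_st s_in = -c_st c_in`.
    have hf : ∀ i, (s i).fst * (s i).fst = 1 - (c i).fst * (c i).fst := fun i => by
      simpa using congrArg TrivSqZeroExt.fst (hss i)
    have hg : ∀ i, (s i).fst * (s i).snd = -((c i).fst * (c i).snd) := fun i => by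
      have := congrArg TrivSqZeroExt.snd (hss i)
      rw [TrivSqZeroExt.snd_sub, TrivSqZeroExt.snd_one, DualNumber.snd_mul,
        DualNumber.snd_mul] at this
      linarith
    rcases hcanti i k hik with (h | ⟨h, h'⟩) | h
    · refine Or.inl (Or.inl ?_)
      nlinarith [hf i, hf k, hspos i, hspos k, hc i, hc k]
    · have hse : (s i).fst = (s k).fst := by
        nlinarith [hf i, hf k, hspos i, hspos k, hc i, hc k]
      refine Or.inl (Or.inr ⟨hse, ?_⟩)
      have h1 := hg i
      have h2 := hg k
      rw [hse, ← h] at h1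
      have h3 : (c k).fst * (c k).snd < (c k).fst * (c i).snd := by
        have := (hc k).1
        gcongr
      exact lt_of_mul_lt_mul_left (by rw [h1, h2]; linarith) (hspos k).le
    · have hse : (s i).fst = (s k).fst := by
        have h1 := hf i
        have h2 := hf k
        rw [h] at h2
        nlinarith [hspos i, hspos k]
      refine Or.inr (TrivSqZeroExt.ext hse ?_)
      have h1 := hg i
      have h2 := hg k
      rw [hse] at h1
      rw [h] at h2
      exact mul_left_cancel₀ (hspos k).ne' (h1.trans h2.symm)
  · intro i
    rw [pow_two, pow_two, hss]
    ring
  · rw [conjTranspose_mul, ← Matrix.mul_assoc, Matrix.mul_assoc _ Uᴴ, Matrix.mul_assoc _ (Uᴴ * W₁),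
      hUV, conj_fromBlocks_submatrix_sumAssoc V' V' 1 _ 1 1 (by
        rw [Matrix.mul_one, hV'.1, fromBlocks_one])]
    rfl
  · simp only [Matrix.mul_assoc] at hbot ⊢
    exact hbot

end Matrix

/-! ### Unitary triangularization -/

namespace Matrix

/-- The first element of `Fin (N + 1)`, followed by the others. -/
def finSuccSum (N : ℕ) : Fin (N + 1) ≃ Unit ⊕ Fin N :=
  ((finSuccEquiv N).trans (Equiv.optionEquivSumPUnit (Fin N))).trans (Equiv.sumComm _ _)

lemma finSuccSum_succ {N : ℕ} (i : Fin N) : finSuccSum N i.succ = Sum.inr i := by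
  simp [finSuccSum]

/-- QR factorization: every matrix is made upper trapezoidal by a unitary matrix. -/
lemma exists_unitary_trapezoidal (N : ℕ) : ∀ (ι : Type) [Fintype ι] [DecidableEq ι] (n : ℕ)
    (A : Matrix ι (Fin n) DQ), Fintype.card ι = N →
    ∃ W : Matrix ι (Fin N) DQ, W.IsUnitaryRect ∧
      ∀ (i : Fin N) (k : Fin n), k.val < i.val → (Wᴴ * A) i k = 0 := by
  induction N with
  | zero =>
    intro ι _ _ n A h
    exact ⟨_, IsUnitaryRect.one.submatrix (Equiv.refl ι) (Fintype.equivFinOfCardEq h).symm,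
      fun i => i.elim0⟩
  | succ N ih =>
    intro ι _ _ n A h
    rcases n with _ | n
    · exact ⟨_, IsUnitaryRect.one.submatrix (Equiv.refl ι) (Fintype.equivFinOfCardEq h).symm,
        fun _ k => k.elim0⟩
    have : Nonempty ι := Fintype.card_pos_iff.1 (by omega)
    -- Every column, even an infinitesimal or zero one, is a dual multiple of a unit column, so no
    -- column exchange is needed.
    obtain ⟨y, ρ, -, hy, hxy⟩ := exists_unit_mul (A.submatrix id fun _ : Unit => 0)
    obtain ⟨k, X, hX⟩ := exists_unitary_first_column y hy
    have hcard : Fintype.card (Fin k) = N := by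
      have := hX.card_eq
      simp only [Fintype.card_sum, Fintype.card_unit, Fintype.card_fin] at this ⊢
      omega
    obtain ⟨W, hW, hWA⟩ := ih (Fin k) n (Xᴴ * A.submatrix id Fin.succ) hcard
    let G : Matrix ι (Unit ⊕ Fin N) DQ :=
      fromCols y X * Matrix.fromBlocks (1 : Matrix Unit Unit DQ) 0 0 W
    have hG : Gᴴ * A = fromRows (yᴴ * A) (Wᴴ * (Xᴴ * A)) := by
      simp only [G]
      rw [fromCols_mul_fromBlocks, conjTranspose_fromCols_eq_fromRows_conjTranspose,
        fromRows_mul]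
      simp [Matrix.mul_assoc]
    refine ⟨G.submatrix (Equiv.refl ι) (finSuccSum N),
      (hX.mul (.fromBlocks .one hW)).submatrix _ _, ?_⟩
    intro i l hl
    change (Gᴴ * A) (finSuccSum N i) l = 0
    rw [hG]
    induction i using Fin.cases with
    | zero => exact absurd hl (Nat.not_lt_zero _)
    | succ i =>
      rw [finSuccSum_succ]
      induction l using Fin.cases with
      | zero =>
        change (Wᴴ * (Xᴴ * A.submatrix id fun _ : Unit => 0)) i () = 0
        rw [hxy, mul_dual_smul, (isUnitaryRect_fromCols.1 hX).2.2.1, dual_smul_zero,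
          Matrix.mul_zero]
        rfl
      | succ l => exact hWA i l (by simpa using hl)

end Matrix

/-! ### Block operations on `Fin`-indexed matrices -/

/-- The first `q` and the last `m - q` elements of `Fin m`. -/
def finSplit {q m : ℕ} (h : q ≤ m) : Fin q ⊕ Fin (m - q) ≃ Fin m :=
  finSumFinEquiv.trans (finCongr (by omega))

@[simp] lemma val_finSplit_inl {q m : ℕ} (h : q ≤ m) (i : Fin q) :
    (finSplit h (Sum.inl i)).val = i.val := by simp [finSplit]

@[simp] lemma val_finSplit_inr {q m : ℕ} (h : q ≤ m) (i : Fin (m - q)) :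
    (finSplit h (Sum.inr i)).val = q + i.val := by simp [finSplit]

lemma diagTwo_eq {m q : ℕ} (h : q ≤ m) (U₁ : DQMat q q) (U₂ : DQMat (m - q) (m - q)) :
    diagTwo U₁ U₂ =
      (Matrix.fromBlocks U₁ 0 0 U₂).submatrix (finSplit h).symm (finSplit h).symm := by
  ext1 i k
  obtain ⟨i, rfl⟩ := (finSplit h).surjective i
  obtain ⟨k, rfl⟩ := (finSplit h).surjective k
  rcases i with i | i <;> rcases k with k | k <;> simp [diagTwo]

lemma sigmaB_eq {m q : ℕ} (h : q ≤ m) :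
    sigmaB m q = (Matrix.fromRows (1 : DQMat q q) 0).submatrix (finSplit h).symm
      (Equiv.refl _) := by
  ext1 i k
  obtain ⟨i, rfl⟩ := (finSplit h).surjective i
  rcases i with i | i
  · simp [sigmaB, Matrix.one_apply, Fin.ext_iff]
  · simp [sigmaB]
    omega

/-- Padding as multiplication by a fixed matrix turns its compatibility with other products into
associativity. -/
lemma padCols_eq {m p : ℕ} (n : ℕ) (M : DQMat m p) : padCols n M = M * (sigmaB n p)ᴴ := by
  ext1 i k
  rw [Matrix.mul_apply]
  by_cases h : k.val < p
  · rw [Finset.sum_eq_single ⟨k.val, h⟩]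
    · simp [padCols, sigmaB, h]
    · intro l _ hl
      have : k.val ≠ l.val := fun h => hl (Fin.ext h.symm)
      simp [sigmaB, this]
    · simp
  · rw [Finset.sum_eq_zero]
    · simp [padCols, h]
    intro l _
    have : k.val ≠ l.val := fun h' => h (h' ▸ l.2)
    simp [sigmaB, this]

lemma svdForm_eq (m n t : ℕ) (μ : Fin t → ℝ[ε]) :
    svdForm m n t μ =
      sigmaB m t * (Matrix.diagonal fun a => dualToDQ (μ a)) * (sigmaB n t)ᴴ := by
  rw [← padCols_eq]
  ext1 i k
  by_cases hk : k.val < t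
  · simp only [padCols, hk, Matrix.of_apply, dite_true, Matrix.mul_diagonal, svdForm, sigmaB]
    by_cases h : i.val = k.val
    · simp [h, hk]
    · simp [h]
  · have : ¬ (i.val = k.val ∧ i.val < t) := fun h => hk (h.1 ▸ h.2)
    simp [padCols, svdForm, hk, this]

lemma conjTranspose_sigmaB_mul_self {m q : ℕ} (h : q ≤ m) :
    (sigmaB m q)ᴴ * sigmaB m q = 1 := by
  rw [sigmaB_eq h, Matrix.conjTranspose_submatrix, Matrix.submatrix_mul_equiv,
    Matrix.conjTranspose_fromRows_eq_fromCols_conjTranspose, Matrix.fromCols_mul_fromRows]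
  simp

lemma diagTwo_mul_sigmaB {m q : ℕ} (h : q ≤ m) (U₁ : DQMat q q) (U₂ : DQMat (m - q) (m - q)) :
    diagTwo U₁ U₂ * sigmaB m q = sigmaB m q * U₁ := by
  have e : U₁ = U₁.submatrix (Equiv.refl _) (Equiv.refl _) := by simp
  rw [sigmaB_eq h, diagTwo_eq h, Matrix.submatrix_mul_equiv]
  conv_rhs => rw [e]
  rw [Matrix.submatrix_mul_equiv, Matrix.fromBlocks_mul_fromRows, Matrix.fromRows_mul]
  simp

lemma conjTranspose_diagTwo {m q : ℕ} (U₁ : DQMat q q) (U₂ : DQMat (m - q) (m - q)) (h : q ≤ m) :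
    (diagTwo U₁ U₂)ᴴ = diagTwo U₁ᴴ U₂ᴴ := by
  rw [diagTwo_eq h, diagTwo_eq h, Matrix.conjTranspose_submatrix, Matrix.fromBlocks_conjTranspose]
  simp

lemma diagTwo_mul {m q : ℕ} (h : q ≤ m) (U₁ V₁ : DQMat q q) (U₂ V₂ : DQMat (m - q) (m - q)) :
    diagTwo U₁ U₂ * diagTwo V₁ V₂ = diagTwo (U₁ * V₁) (U₂ * V₂) := by
  rw [diagTwo_eq h, diagTwo_eq h, diagTwo_eq h, Matrix.submatrix_mul_equiv,
    Matrix.fromBlocks_multiply]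
  simp

lemma isUnitaryDQ_iff {m : ℕ} (U : DQMat m m) : IsUnitaryDQ U ↔ U.IsUnitaryRect := Iff.rfl

lemma isUnitaryDQ_diagTwo {m q : ℕ} (h : q ≤ m) {U₁ : DQMat q q} {U₂ : DQMat (m - q) (m - q)}
    (h₁ : IsUnitaryDQ U₁) (h₂ : IsUnitaryDQ U₂) : IsUnitaryDQ (diagTwo U₁ U₂) := by
  rw [diagTwo_eq h]
  exact (Matrix.IsUnitaryRect.fromBlocks h₁ h₂).submatrix _ _

lemma padCols_mul_diagTwo {m n p : ℕ} (h : p ≤ n) (M : DQMat m p) (X : DQMat p p)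
    (Y : DQMat (n - p) (n - p)) : padCols n M * diagTwo X Y = padCols n (M * X) := by
  have : (sigmaB n p)ᴴ * diagTwo X Y = X * (sigmaB n p)ᴴ := by
    rw [← Matrix.conjTranspose_conjTranspose (diagTwo X Y), ← Matrix.conjTranspose_mul,
      conjTranspose_diagTwo X Y h, diagTwo_mul_sigmaB h, Matrix.conjTranspose_mul,
      Matrix.conjTranspose_conjTranspose]
  rw [padCols_eq, padCols_eq, Matrix.mul_assoc, this, Matrix.mul_assoc]

lemma mul_padCols {l m n p : ℕ} (N : DQMat l m) (M : DQMat m p) :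
    N * padCols n M = padCols n (N * M) := by
  rw [padCols_eq, padCols_eq, Matrix.mul_assoc]

lemma conjTranspose_sigmaB_mul_apply {m n p : ℕ} (M : DQMat n m) (i : Fin n) (hi : i.val < p)
    (k : Fin m) : ((sigmaB n p)ᴴ * M) ⟨i.val, hi⟩ k = M i k := by
  rw [Matrix.mul_apply, Finset.sum_eq_single i]
  · simp [sigmaB]
  · intro l _ hl
    have : l.val ≠ i.val := fun h => hl (Fin.ext h)
    simp [sigmaB, this]
  · simp

/-! ### The rank and unitary decompositions -/

/-- A predicate that holds on an initial segment of `Fin t` cuts out the elements below some `r`. -/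
lemma exists_forall_iff_lt {t : ℕ} (p : Fin t → Prop) (h : ∀ a b, a ≤ b → p b → p a) :
    ∃ r ≤ t, ∀ a, p a ↔ a.val < r := by
  classical
  by_cases hall : ∀ a, p a
  · exact ⟨t, le_rfl, fun a => ⟨fun _ => a.2, fun _ => hall a⟩⟩
  have hex : ∃ k, ∃ hk : k < t, ¬ p ⟨k, hk⟩ := by
    push Not at hall
    obtain ⟨a, ha⟩ := hall
    exact ⟨a.1, a.2, ha⟩
  obtain ⟨hk, hnot⟩ := Nat.find_spec hex
  refine ⟨Nat.find hex, hk.le, fun a => ⟨fun ha => ?_, fun ha => ?_⟩⟩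
  · by_contra hlt
    exact hnot (h ⟨_, hk⟩ a (not_lt.1 hlt) ha)
  · by_contra hna
    exact Nat.find_min hex ha ⟨a.2, hna⟩

/-- This makes the infima defining the ranks attained. That, with the bound of the appreciable rank
by any decomposition, is all that is used of them; uniqueness of singular values is not needed. -/
lemma exists_isDQSVD {m n : ℕ} (A : DQMat m n) :
    ∃ (r t : ℕ) (μ : Fin t → ℝ[ε]) (U : DQMat m m) (V : DQMat n n), IsDQSVD A U V r t μ := by
  obtain ⟨t, a, b, U, V, μ, hU, hV, hμ, hanti, hUV⟩ := A.exists_svd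
  obtain rfl : m = t + a := by simpa using hU.card_eq
  obtain rfl : n = t + b := by simpa using hV.card_eq
  have hnn : ∀ i, 0 ≤ (μ i).fst := fun i => by
    rcases hμ i with h | h
    · exact h.le
    · exact h.1.le
  obtain ⟨r, hr, hrμ⟩ := exists_forall_iff_lt (fun i => DualAppreciable (μ i)) (by
    intro i k hik hk
    have hk' : 0 < (μ k).fst := lt_of_le_of_ne (hnn k) (Ne.symm hk)
    rcases hanti i k hik with (h | h) | h
    · exact (hk'.trans h).ne'
    · rw [h.1] at hk'
      exact hk'.ne'
    · rw [h] at hk'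
      exact hk'.ne')
  refine ⟨r, t, μ, U.submatrix (Equiv.refl _) finSumFinEquiv.symm,
    V.submatrix (Equiv.refl _) finSumFinEquiv.symm, hU.submatrix _ _, hV.submatrix _ _, hr,
    by simp, ?_, hμ, hanti, hrμ⟩
  rw [Matrix.conj_submatrix, hUV]
  ext1 i k
  obtain ⟨i, rfl⟩ := finSumFinEquiv.surjective i
  obtain ⟨k, rfl⟩ := finSumFinEquiv.surjective k
  rw [Matrix.submatrix_apply, Equiv.symm_apply_apply, Equiv.symm_apply_apply]
  rcases i with i | i <;> rcases k with k | k
  · by_cases h : i = k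
    · simp [svdForm, h]
    · simp [svdForm, h, Fin.ext_iff.not.1 h]
  · simp [svdForm]
    omega
  · simp [svdForm]
  · simp [svdForm]

lemma isUnit_of_isUnitaryDQ {m : ℕ} {U : DQMat m m} (hU : IsUnitaryDQ U) : IsUnit U :=
  ⟨⟨U, Uᴴ, hU.2, hU.1⟩, rfl⟩

/-- A matrix of rank `p` has a unitary decomposition with `p` orthonormal columns, and its right
factor is nonsingular if the appreciable rank is `p` too. -/
lemma exists_isUnitaryDecomp {m n p : ℕ} (A : DQMat m n) (hA : dqRank A = p) :
    p ≤ m ∧ p ≤ n ∧ ∃ (P : DQMat m p) (R : DQMat n n), IsUnitaryDecomp A P R ∧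
      (dqArank A = p → IsUnit R) := by
  obtain ⟨r, μ, U, V, h⟩ : ∃ (r : ℕ) (μ : Fin p → ℝ[ε]) (U : DQMat m m) (V : DQMat n n),
      IsDQSVD A U V r p μ := by
    rw [← hA]
    obtain ⟨r, t, μ, U, V, h⟩ := exists_isDQSVD A
    exact Nat.sInf_mem (s := {t | ∃ (r : ℕ) (μ : Fin t → ℝ[ε]) (U : DQMat m m) (V : DQMat n n),
      IsDQSVD A U V r t μ}) ⟨t, r, μ, U, V, h⟩
  have hpm : p ≤ m := h.t_le.trans (min_le_left _ _)
  have hpn : p ≤ n := h.t_le.trans (min_le_right _ _)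
  set D : DQMat p p := Matrix.diagonal fun a => dualToDQ (μ a) with hD
  obtain ⟨W, hW, hT⟩ := Matrix.exists_unitary_trapezoidal p (Fin p) n (D * (sigmaB n p)ᴴ * Vᴴ)
    (Fintype.card_fin p)
  have hU := (isUnitaryDQ_iff U).1 h.unitary_left
  have hV := (isUnitaryDQ_iff V).1 h.unitary_right
  have hrow : (sigmaB n p)ᴴ * (diagTwo (Wᴴ * D) 1 * Vᴴ) = Wᴴ * (D * (sigmaB n p)ᴴ * Vᴴ) := by
    have := padCols_mul_diagTwo hpn (1 : DQMat p p) (Wᴴ * D) 1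
    rw [padCols_eq, padCols_eq, Matrix.one_mul, Matrix.one_mul] at this
    rw [← Matrix.mul_assoc, this]
    simp only [Matrix.mul_assoc]
  -- The nonzero rows of the decomposition are triangularized by `W`, which is undone in the
  -- orthonormal factor. The rest of `R` is filled with the remaining rows of `Vᴴ`, so only `D` can
  -- make `R` singular; the column permutation is the identity.
  refine ⟨hpm, hpn, U * sigmaB m p * W, diagTwo (Wᴴ * D) 1 * Vᴴ, ⟨?_, ?_, 1, ?_⟩, ?_⟩
  · simp only [Matrix.conjTranspose_mul, Matrix.mul_assoc]
    rw [hU.mul_cancel_left, ← Matrix.mul_assoc (sigmaB m p)ᴴ, conjTranspose_sigmaB_mul_self hpm,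
      Matrix.one_mul, hW.1]
  · rw [← Matrix.mul_assoc, padCols_mul_diagTwo hpn, Matrix.mul_assoc _ W, hW.mul_cancel_left',
      padCols_eq, Matrix.mul_assoc U, Matrix.mul_assoc U, hD, ← svdForm_eq, ← h.eq]
    simp only [Matrix.mul_assoc]
    rw [hU.mul_cancel_left', hV.2, Matrix.mul_one]
  · intro i k hi hk
    rw [← conjTranspose_sigmaB_mul_apply (diagTwo (Wᴴ * D) 1 * Vᴴ) i hi, hrow]
    exact hT _ _ hk
  · intro hAr
    have hr : r = p := by
      refine le_antisymm h.r_le ?_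
      -- The appreciable rank is at most `r`, being an infimum; hence `r = p`, all singular values
      -- are invertible, and so is `D`.
      rw [← hAr]
      exact Nat.sInf_le ⟨p, μ, U, V, h⟩
    have hne : ∀ a, (μ a).fst ≠ 0 := fun a => (h.appreciable_iff a).2 (by rw [hr]; exact a.2)
    choose ν hν _ using fun a => exists_dual_inv (μ a) (hne a)
    have h1 : D * (Matrix.diagonal fun a => dualToDQ (ν a)) = 1 := by
      simp [hD, ← dualToDQ_mul, hν]
    have h2 : (Matrix.diagonal fun a => dualToDQ (ν a)) * D = 1 := by
      simp [hD, ← dualToDQ_mul, mul_comm (ν _), hν]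
    have hone : diagTwo (1 : DQMat p p) (1 : DQMat (n - p) (n - p)) = 1 := by
      rw [diagTwo_eq hpn]
      simp
    refine IsUnit.mul ⟨⟨diagTwo (Wᴴ * D) 1,
      diagTwo ((Matrix.diagonal fun a => dualToDQ (ν a)) * W) 1, ?_, ?_⟩, rfl⟩
      (isUnit_of_isUnitaryDQ hV.conjTranspose)
    · rw [diagTwo_mul hpn, Matrix.mul_assoc, ← Matrix.mul_assoc D, h1, Matrix.one_mul, hW.1,
        Matrix.one_mul, hone]
    · rw [diagTwo_mul hpn, Matrix.mul_assoc, hW.mul_cancel_left', h2, Matrix.one_mul, hone]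

/-! ### The canonical correlation decomposition -/

lemma exists_unitary_mul_sigmaB {m q : ℕ} (h : q ≤ m) (P : DQMat m q) (hP : Pᴴ * P = 1) :
    ∃ Q : DQMat m m, IsUnitaryDQ Q ∧ P = Q * sigmaB m q := by
  obtain ⟨k, X, hX⟩ := Matrix.exists_unitary_fromCols P hP
  obtain rfl : k = m - q := by
    have := hX.card_eq
    simp only [Fintype.card_sum, Fintype.card_fin] at this
    omega
  refine ⟨(Matrix.fromCols P X).submatrix (Equiv.refl _) (finSplit h).symm, hX.submatrix _ _, ?_⟩
  rw [sigmaB_eq h, Matrix.submatrix_mul_equiv, Matrix.fromCols_mul_fromRows]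
  simp

/-- Indexes the lower block by `Fin (m - q)`, so that it matches the splitting on which `diagTwo`
acts. -/
lemma sigmaA_eq {m p q r u j t v z w : ℕ} (h : q ≤ m)
    (hq : r + (u + (j + (t + v))) = q) (hp : r + (u + (j + (t + w))) = p)
    (hm : q + (r + (z + (j + (t + w)))) = m) (hm' : r + (z + (j + (t + w))) = m - q)
    (σ : Fin r → ℝ) (c s : Fin j → ℝ[ε]) (d : Fin t → ℝ) :
    sigmaA hq hp hm σ c s d = (Matrix.fromRows
      ((sigmaTop r u j t v w c d).submatrix ((fiveEquiv r u j t v).trans (finCongr hq)).symm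
        ((fiveEquiv r u j t w).trans (finCongr hp)).symm)
      ((sigmaBot r u z j t w σ s).submatrix ((fiveEquiv r z j t w).trans (finCongr hm')).symm
        ((fiveEquiv r u j t w).trans (finCongr hp)).symm)).submatrix
        (finSplit h).symm (Equiv.refl _) := by
  subst hq hp
  have hF : ((((fiveEquiv r u j t v).trans (finCongr rfl)).sumCongr
      (fiveEquiv r z j t w)).trans finSumFinEquiv).trans (finCongr hm) =
      (((fiveEquiv r u j t v).trans (finCongr rfl)).sumCongr
        ((fiveEquiv r z j t w).trans (finCongr hm'))).trans (finSplit h) := by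
    ext x
    rcases x with x | x <;> simp
  rw [sigmaA, hF]
  ext1 i k
  obtain ⟨i, rfl⟩ := (finSplit h).surjective i
  rcases i with i | i <;> simp

theorem mainTheorem5 {m n l p q : ℕ} (A : DQMat m n) (B : DQMat m l)
    (hA : dqRank A = p) (hB : dqRank B = q) :
    ∃ (r u j t v z w : ℕ)
      (hq : r + (u + (j + (t + v))) = q) (hp : r + (u + (j + (t + w))) = p)
      (hm : q + (r + (z + (j + (t + w)))) = m)
      (σ : Fin r → ℝ) (c s : Fin j → ℝ[ε]) (d : Fin t → ℝ)
      (Q : DQMat m m) (XA : DQMat n n) (XB : DQMat l l),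
      -- the two decompositions
      IsUnitaryDQ Q ∧
      A = Q * padCols n (sigmaA hq hp hm σ c s d) * XA ∧
      B = Q * padCols l (sigmaB m q) * XB ∧
      -- the diagonal blocks
      (∀ a, 0 < σ a) ∧ Antitone σ ∧
      (∀ a, 0 < d a) ∧ Antitone d ∧
      (∀ a, DualAppreciable (c a) ∧ DualLT 0 (c a) ∧ DualLT (c a) 1) ∧
      (∀ a b, a ≤ b → DualLE (c b) (c a)) ∧
      (∀ a, DualAppreciable (s a) ∧ DualLT 0 (s a) ∧ DualLT (s a) 1) ∧
      (∀ a b, a ≤ b → DualLE (s a) (s b)) ∧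
      (∀ a, c a ^ 2 + s a ^ 2 = 1) ∧
      -- nonsingularity of the right factors
      (dqArank A = p → IsUnit XA) ∧
      (dqArank B = q → IsUnit XB) ∧
      -- the form of `Q`, `XA`, `XB`
      ∃ (PA : DQMat m p) (RA : DQMat n n) (PB : DQMat m q) (RB : DQMat l l) (Q₂ : DQMat m m)
        (U₁ : DQMat q q) (U₂ : DQMat (m - q) (m - q)) (V₁ : DQMat p p),
        IsUnitaryDecomp A PA RA ∧ IsUnitaryDecomp B PB RB ∧
        IsUnitaryDQ Q₂ ∧ PB = Q₂ * sigmaB m q ∧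
        IsUnitaryDQ U₁ ∧ IsUnitaryDQ U₂ ∧ IsUnitaryDQ V₁ ∧
        (diagTwo U₁ U₂)ᴴ * (Q₂ᴴ * PA) * V₁ = sigmaA hq hp hm σ c s d ∧
        Q = Q₂ * diagTwo U₁ U₂ ∧
        XA = (diagTwo V₁ 1)ᴴ * RA ∧
        XB = (diagTwo U₁ 1)ᴴ * RB := by
  obtain ⟨-, hpn, PA, RA, hdA, hRA⟩ := exists_isUnitaryDecomp A hA
  obtain ⟨hqm, hql, PB, RB, hdB, hRB⟩ := exists_isUnitaryDecomp B hB
  obtain ⟨Q₂, hQ₂, hPB⟩ := exists_unitary_mul_sigmaB hqm PB hdB.1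
  have hQ₂' := (isUnitaryDQ_iff Q₂).1 hQ₂
  obtain ⟨W₁, W₂, hW⟩ : ∃ (W₁ : DQMat q p) (W₂ : DQMat (m - q) p), Q₂ᴴ * PA =
      (Matrix.fromRows W₁ W₂).submatrix (finSplit hqm).symm (Equiv.refl _) :=
    ⟨((Q₂ᴴ * PA).submatrix (finSplit hqm) id).toRows₁,
      ((Q₂ᴴ * PA).submatrix (finSplit hqm) id).toRows₂, by simp⟩
  -- The columns of `Q₂ᴴ * PA` stay orthonormal, which is the hypothesis of the CS decomposition for
  -- its two row blocks.
  have hgram : W₁ᴴ * W₁ + W₂ᴴ * W₂ = 1 := by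
    have h1 : (Q₂ᴴ * PA)ᴴ * (Q₂ᴴ * PA) = 1 := by
      rw [Matrix.conjTranspose_mul, Matrix.conjTranspose_conjTranspose, Matrix.mul_assoc,
        hQ₂'.mul_cancel_left', hdA.1]
    rw [hW, Matrix.conjTranspose_submatrix, Matrix.submatrix_mul_equiv,
      Matrix.conjTranspose_fromRows_eq_fromCols_conjTranspose,
      Matrix.fromCols_mul_fromRows] at h1
    simpa using h1
  obtain ⟨r, u, j, t, v, z, w, σ, c, s, d, U₁, U₂, V₁, hU₁, hU₂, hV₁, hσ, hσ', hd, hd', hc, hc',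
    hs, hs', hcs, htop, hbot⟩ := Matrix.exists_cs_decomposition W₁ W₂ hgram
  -- The size identities hold because unitary matrices are square.
  have hq : r + (u + (j + (t + v))) = q := by simpa using hU₁.card_eq.symm
  have hp : r + (u + (j + (t + w))) = p := by simpa using hV₁.card_eq.symm
  have hm' : r + (z + (j + (t + w))) = m - q := by simpa using hU₂.card_eq.symm
  have hm : q + (r + (z + (j + (t + w)))) = m := by omega
  let e₁ := (fiveEquiv r u j t v).trans (finCongr hq)
  let e₂ := (fiveEquiv r z j t w).trans (finCongr hm')
  let e₃ := (fiveEquiv r u j t w).trans (finCongr hp)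
  let U₁' : DQMat q q := U₁.submatrix (Equiv.refl _) e₁.symm
  let U₂' : DQMat (m - q) (m - q) := U₂.submatrix (Equiv.refl _) e₂.symm
  let V₁' : DQMat p p := V₁.submatrix (Equiv.refl _) e₃.symm
  have hU₁' : IsUnitaryDQ U₁' := hU₁.submatrix _ _
  have hU₂' : IsUnitaryDQ U₂' := hU₂.submatrix _ _
  have hV₁' : IsUnitaryDQ V₁' := hV₁.submatrix _ _
  have hone : ∀ k : ℕ, IsUnitaryDQ (1 : DQMat k k) := fun k => Matrix.IsUnitaryRect.one
  have hdiag := isUnitaryDQ_diagTwo hqm hU₁' hU₂'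
  have hsigma : (diagTwo U₁' U₂')ᴴ * (Q₂ᴴ * PA) * V₁' = sigmaA hq hp hm σ c s d := by
    have e : V₁' = V₁'.submatrix (Equiv.refl _) (Equiv.refl _) := by simp
    rw [sigmaA_eq hqm hq hp hm hm', hW, conjTranspose_diagTwo _ _ hqm, diagTwo_eq hqm,
      Matrix.submatrix_mul_equiv]
    conv_lhs => rw [e]
    rw [Matrix.submatrix_mul_equiv, Matrix.fromBlocks_mul_fromRows, Matrix.fromRows_mul,
      ← htop, ← hbot]
    simp only [Matrix.zero_mul, add_zero, zero_add]
    rfl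
  have hA' : A = Q₂ * diagTwo U₁' U₂' * padCols n (sigmaA hq hp hm σ c s d) *
      ((diagTwo V₁' 1)ᴴ * RA) := by
    rw [← Matrix.mul_assoc, conjTranspose_diagTwo _ _ hpn, mul_padCols, padCols_mul_diagTwo hpn,
      ← hsigma]
    simp only [Matrix.mul_assoc, hV₁'.2, Matrix.mul_one]
    rw [Matrix.IsUnitaryRect.mul_cancel_left' hdiag, hQ₂'.mul_cancel_left']
    exact hdA.2.1
  -- Moving `diag(U₁, U₂)` past `sigmaB` leaves `U₁`, which cancels against the `U₁ᴴ` in the right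
  -- factor.
  have hB' : B = Q₂ * diagTwo U₁' U₂' * padCols l (sigmaB m q) *
      ((diagTwo U₁' 1)ᴴ * RB) := by
    rw [← Matrix.mul_assoc, conjTranspose_diagTwo _ _ hql, mul_padCols, padCols_mul_diagTwo hql,
      Matrix.mul_assoc Q₂, diagTwo_mul_sigmaB hqm]
    simp only [Matrix.mul_assoc, hU₁'.2, Matrix.mul_one]
    rw [← hPB]
    exact hdB.2.1
  refine ⟨r, u, j, t, v, z, w, hq, hp, hm, σ, c, s, d, Q₂ * diagTwo U₁' U₂',
    (diagTwo V₁' 1)ᴴ * RA, (diagTwo U₁' 1)ᴴ * RB, hQ₂'.mul hdiag, hA', hB', hσ, hσ', hd, hd', hc,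
    hc', hs, hs', hcs, fun h => ?_, fun h => ?_, PA, RA, PB, RB, Q₂, U₁', U₂', V₁', hdA, hdB, hQ₂,
    hPB, hU₁', hU₂', hV₁', hsigma, rfl, rfl, rfl⟩
  · exact (isUnit_of_isUnitaryDQ
      (Matrix.IsUnitaryRect.conjTranspose (isUnitaryDQ_diagTwo hpn hV₁' (hone _)))).mul (hRA h)
  · exact (isUnit_of_isUnitaryDQ
      (Matrix.IsUnitaryRect.conjTranspose (isUnitaryDQ_diagTwo hql hU₁' (hone _)))).mul (hRB h)
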